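/- **Setting.** Let $R$ be a finite group, let $X$ be its underlying set with distinguished letter $e$ (the identity), and let $\mathrm{Aut}(X^*)$ be the automorphism group of the rooted tree $X^*$ of finite words over $X$. For $g\in \mathrm{Aut}(X^*)$ and a word $v$, the section $g|_v\in\mathrm{Aut}(X^*)$ is defined by $g(vu)=g(v)\,g|_v(u)$ for all words $u$. Identify $R$ with the group of rooted automorphisms $xw\mapsto (rx)w$ ($r\in R$, $x\in X$, $w\in X^*$). An automorphism $d$ is *directed* if it fixes every letter $x\in X$, $d|_e=d$, and $d|_x\in R$ for all $x\neq e$. If $D\le \mathrm{Aut}(X^*)$ is a group of directed automorphisms with $\langle d|_x : d\in D,\ x\in X\setminus\{e\}\rangle=R$, then $G=\langle R\cup D\rangle$ is called a *constant spinal group*. A *special* subgroup of $G$ is a subgroup that is conjugate in $G$ to $\langle R\cup T\rangle$ for some subgroup $T\le D$. A subgroup $H\le G$ is *prodense* if $HN=G$ for every non-trivial normal subgroup $N$ of $G$. For a subgroup $K\le\mathrm{Aut}(X^*)$ let $\psi(K^X)$ be the group of all automorphisms that fix every letter and have all their sections at letters in $K$. A subgroup $H\le\mathrm{Aut}(X^*)$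 acting transitively on each set $X^n$ is *regular branch over* a finite index subgroup $K\le H$ if $\psi(K^X)$ is contained in $K$ as a subgroup of finite index. **Theorem.** Let $G=\langle R\cup D\rangle$ be a constant spinal group, let $T\le D$ be a subgroup, and let $H$ be a prodense special subgroup of $G$ that is conjugate in $G$ to $\langle R\cup T\rangle$ and that is regular branch over its commutator subgroup $H'$. Then $H$ is a maximal subgroup of $G$ if and only if $T$ is a maximal subgroup of $D$. -/

import Mathlib

open scoped Pointwise

section TreeAutomorphisms

/-- The automorphism group of the rooted tree `X^*` of all finite words over the alphabet `X`
(the root is the empty word, the `n`-th layer consists of the words of length `n`): the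
permutations of the words which preserve the length and the prefix relation. -/
def treeAut (X : Type*) : Subgroup (Equiv.Perm (List X)) where
  carrier := {g | (∀ u, (g u).length = u.length) ∧ ∀ u v, u <+: v → g u <+: g v}
  one_mem' := ⟨fun _ => rfl, fun _ _ h => h⟩
  mul_mem' := by
    rintro a b ⟨ha, ha'⟩ ⟨hb, hb'⟩
    exact ⟨fun u => by simp [ha, hb], fun u v h => ha' _ _ (hb' _ _ h)⟩
  inv_mem' := by
    rintro a ⟨ha, ha'⟩
    have hl : ∀ u, (a⁻¹ u).length = u.length := fun u => by
      rw [← ha (a⁻¹ u)]; simp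
    refine ⟨hl, fun u v h => ?_⟩
    have h1 : a ((a⁻¹ v).take u.length) <+: v := by
      simpa using ha' _ _ (List.take_prefix u.length (a⁻¹ v))
    have h2 : (a ((a⁻¹ v).take u.length)).length = u.length := by
      rw [ha, List.length_take, hl, min_eq_left h.length_le]
    have h3 : a ((a⁻¹ v).take u.length) = u :=
      (List.prefix_of_prefix_length_le h1 h h2.le).eq_of_length h2
    have h4 : a⁻¹ u = (a⁻¹ v).take u.length := by
      rw [Equiv.Perm.inv_eq_iff_eq, h3]
    rw [h4]
    exact List.take_prefix _ _

/-- The group `Aut(X^*)`. -/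
abbrev TreeAut (X : Type*) := ↥(treeAut X)

variable {X : Type*}

theorem TreeAut.length_apply (g : TreeAut X) (u : List X) : (g.1 u).length = u.length :=
  g.2.1 u

theorem TreeAut.apply_append (g : TreeAut X) (v u : List X) :
    g.1 (v ++ u) = g.1 v ++ (g.1 (v ++ u)).drop v.length := by
  obtain ⟨t, ht⟩ := g.2.2 v (v ++ u) (List.prefix_append v u)
  rw [← ht]
  simp [← g.length_apply v]

/-- The section `g|_v` of `g` at the vertex `v`: the automorphism determined by
`g (v u) = g(v) g|_v(u)` for all words `u`. -/
def TreeAut.sec (g : TreeAut X) (v : List X) : TreeAut X :=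
  ⟨{ toFun := fun u => (g.1 (v ++ u)).drop v.length
     invFun := fun u => (g.1⁻¹ (g.1 v ++ u)).drop v.length
     left_inv := fun u => by
      change ((g.1⁻¹ (g.1 v ++ (g.1 (v ++ u)).drop v.length)).drop v.length) = u
      rw [← g.apply_append]
      simp
     right_inv := fun u => by
      have h := (g⁻¹).apply_append (g.1 v) u
      have hv : (g⁻¹).1 (g.1 v) = v := by simp
      rw [hv, g.length_apply] at h
      change (g.1 (v ++ ((g⁻¹).1 (g.1 v ++ u)).drop v.length)).drop v.length = u
      rw [← h, ← g.length_apply v]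
      simp },
    fun u => by simp [g.length_apply], by
      rintro u _ ⟨w, rfl⟩
      obtain ⟨t, ht⟩ := g.2.2 (v ++ u) (v ++ (u ++ w)) ⟨w, by simp⟩
      refine ⟨t, ?_⟩
      simp only [Equiv.coe_fn_mk]
      rw [← ht, List.drop_append_of_le_length]
      simp [g.length_apply]⟩

theorem TreeAut.apply_append_sec (g : TreeAut X) (v u : List X) :
    g.1 (v ++ u) = g.1 v ++ (g.sec v).1 u :=
  g.apply_append v u

/-- The embedding of `Sym(X)` into `Aut(X^*)` by rooted automorphisms: `σ` acts on the first letter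
of a word only. -/
def rootedHom (X : Type*) : Equiv.Perm X →* TreeAut X where
  toFun σ :=
    ⟨{ toFun := fun
        | [] => []
        | x :: w => σ x :: w
       invFun := fun
        | [] => []
        | x :: w => σ⁻¹ x :: w
       left_inv := by rintro (_ | ⟨x, w⟩) <;> simp
       right_inv := by rintro (_ | ⟨x, w⟩) <;> simp },
      by rintro (_ | ⟨x, w⟩) <;> simp, by
        rintro (_ | ⟨x, w⟩) v ⟨t, rfl⟩
        · exact List.nil_prefix
        · exact ⟨t, rfl⟩⟩
  map_one' := by
    ext1; ext1 u
    cases u <;> rfl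
  map_mul' σ τ := by
    ext1; ext1 u
    cases u <;> rfl

/-- The embedding `ψ : Aut(X^*)^X → Aut(X^*)` onto the stabiliser of the first layer; the element
`ψ f` fixes the first layer pointwise and has section `f x` at the letter `x`. -/
def branchHom (X : Type*) : (X → TreeAut X) →* TreeAut X where
  toFun f :=
    ⟨{ toFun := fun
        | [] => []
        | x :: w => x :: (f x).1 w
       invFun := fun
        | [] => []
        | x :: w => x :: (f x).1⁻¹ w
       left_inv := by rintro (_ | ⟨x, w⟩) <;> simp
       right_inv := by rintro (_ | ⟨x, w⟩) <;> simp },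
      by rintro (_ | ⟨x, w⟩) <;> simp [TreeAut.length_apply], by
        rintro (_ | ⟨x, w⟩) v ⟨t, rfl⟩
        · exact List.nil_prefix
        · exact List.cons_prefix_cons.2 ⟨rfl, (f x).2.2 w (w ++ t) (List.prefix_append w t)⟩⟩
  map_one' := by
    ext1; ext1 u
    cases u <;> rfl
  map_mul' f g := by
    ext1; ext1 u
    cases u <;> rfl

/-- `G` acts transitively on every layer of the tree. -/
def IsSphericallyTransitive (G : Subgroup (TreeAut X)) : Prop :=
  ∀ u v : List X, u.length = v.length → ∃ g ∈ G, g.1 u = v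

/-- The subgroup `ψ(K^X)`, the geometric product of `X` copies of `K`. -/
def geometricPower (K : Subgroup (TreeAut X)) : Subgroup (TreeAut X) :=
  (Subgroup.pi Set.univ fun _ : X => K).map (branchHom X)

/-- The spherically transitive group `G` is regular branch over its finite index subgroup `K`:
`ψ(K^X)` is contained in `K` as a subgroup of finite index. -/
structure IsRegularBranchOver (G K : Subgroup (TreeAut X)) : Prop where
  transitive : IsSphericallyTransitive G
  le : K ≤ G
  finiteIndex : K.IsFiniteRelIndex G
  geometric_le : geometricPower K ≤ K
  geometric_finiteIndex : (geometricPower K).IsFiniteRelIndex K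

end TreeAutomorphisms

/-- The subgroup `H` of `G` is prodense in `G`: `H N = G` for all non-trivial normal subgroups `N`
of `G`. -/
def IsProdenseIn {A : Type*} [Group A] (H G : Subgroup A) : Prop :=
  H ≤ G ∧ ∀ N : Subgroup A, N ≤ G → (N.subgroupOf G).Normal → N ≠ ⊥ →
    (H : Set A) * (N : Set A) = (G : Set A)

section ConstantSpinal

/-- The copy of the group `R` in `Aut(R^*)` consisting of the rooted automorphisms that act on the
first letter by left multiplication by an element of `R`. -/
def rootedGroup (R : Type*) [Group R] : Subgroup (TreeAut R) :=
  ((rootedHom R).comp (MulAction.toPermHom R R)).range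

variable {R : Type*} [Group R]

/-- The automorphism `d` is directed (with labels in `R`): it fixes the first layer pointwise, has
section `d` itself at the letter `1`, and all its sections at letters `x ≠ 1` are rooted
automorphisms given by elements of `R`. -/
structure IsDirectedAut (d : TreeAut R) : Prop where
  fix : ∀ x : R, d.1 [x] = [x]
  sec_one : d.sec [1] = d
  sec_ne_one : ∀ x : R, x ≠ 1 → d.sec [x] ∈ rootedGroup R

/-- `D` can serve as the directed group of a constant spinal group with rooted group `R`: it
consists of directed automorphisms, and the sections of its elements at the letters `x ≠ 1`
generate `R`. -/
structure IsDirectedGroup (D : Subgroup (TreeAut R)) : Prop where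
  directed : ∀ d ∈ D, IsDirectedAut d
  generates : Subgroup.closure {s : TreeAut R | ∃ d ∈ D, ∃ x : R, x ≠ 1 ∧ s = d.sec [x]} =
    rootedGroup R

/-- The group `⟨R ∪ D⟩`. -/
def spinalGroup (D : Subgroup (TreeAut R)) : Subgroup (TreeAut R) :=
  Subgroup.closure ((rootedGroup R : Set (TreeAut R)) ∪ (D : Set (TreeAut R)))

end ConstantSpinal

/-! Write G = ⟨R ∪ D⟩ and S = ⟨R ∪ T⟩. Conjugation by an element of G preserves maximality, so H may
be replaced by S. That S ∩ D = T (`spinalGroup_inf`) makes E ↦ ⟨R ∪ E⟩ strictly increasing on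
subgroups of D, so maximality of S forces maximality of T.

Conversely, let T be maximal, S ≤ M < G and m ∈ M. Deep sections of m are rooted or directed,
because passing to sections shortens words. They lie in iterated first-section groups of M, which
contain S and stay proper (`spinalGroup_le_of_le_firstSec`); such a group meets D exactly in T, so
the deep sections lie in S (`sec_mem_of_covBy`). Density gives G = S · ψ(G'^X), and S ∩ G' ≤ (T ∩
D') S'; together these lift membership in S from the sections to m (`mem_of_sec_singleton_mem`).

That lifting needs S to contain ψ(S'^X), whereas branching is assumed for H = gSg⁻¹. The remaining
work shows H' = S' (`commutator_eq_commutator`): all sections of g at some layer lie in S, whence H'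
≤ S', and an index count gives equality. -/

namespace TreeAut

/-! ### Calculus of sections and first-layer actions. -/

section Basic

variable {X : Type*}

theorem ext_apply {a b : TreeAut X} (h : ∀ u, a.1 u = b.1 u) : a = b :=
  Subtype.ext (Equiv.ext h)

@[simp]
theorem apply_nil (g : TreeAut X) : g.1 [] = [] :=
  List.length_eq_zero_iff.1 (g.length_apply [])

@[simp]
theorem mul_apply (a b : TreeAut X) (u : List X) : (a * b).1 u = a.1 (b.1 u) := rfl

@[simp]
theorem one_apply (u : List X) : (1 : TreeAut X).1 u = u := rfl

@[simp]
theorem inv_apply_apply (a : TreeAut X) (u : List X) : (a⁻¹).1 (a.1 u) = u := by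
  rw [← mul_apply, inv_mul_cancel, one_apply]

@[simp]
theorem apply_inv_apply (a : TreeAut X) (u : List X) : a.1 ((a⁻¹).1 u) = u := by
  rw [← mul_apply, mul_inv_cancel, one_apply]

/-- The action of a tree automorphism on the first layer. -/
def letter (g : TreeAut X) (x : X) : X :=
  (g.1 [x]).head (List.ne_nil_of_length_pos (by simp [g.length_apply]))

theorem apply_singleton (g : TreeAut X) (x : X) : g.1 [x] = [g.letter x] := by
  obtain ⟨y, hy⟩ := List.length_eq_one_iff.1 (g.length_apply [x])
  simp [letter, hy]

theorem apply_cons (g : TreeAut X) (x : X) (u : List X) :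
    g.1 (x :: u) = g.letter x :: (g.sec [x]).1 u := by
  have := g.apply_append_sec [x] u
  rw [apply_singleton] at this
  simpa using this

@[simp]
theorem sec_nil (g : TreeAut X) : g.sec [] = g :=
  ext_apply fun u => by simpa using (g.apply_append_sec [] u).symm

theorem sec_append (g : TreeAut X) (v w : List X) : g.sec (v ++ w) = (g.sec v).sec w :=
  ext_apply fun u => by
    have h1 := g.apply_append_sec (v ++ w) u
    rw [List.append_assoc, g.apply_append_sec v, g.apply_append_sec v,
      (g.sec v).apply_append_sec w, List.append_assoc] at h1
    exact (List.append_cancel_left (List.append_cancel_left h1)).symm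

theorem sec_cons (g : TreeAut X) (x : X) (v : List X) : g.sec (x :: v) = (g.sec [x]).sec v :=
  g.sec_append [x] v

theorem mul_sec (a b : TreeAut X) (v : List X) : (a * b).sec v = a.sec (b.1 v) * b.sec v :=
  ext_apply fun u => by
    have h := (a * b).apply_append_sec v u
    rw [mul_apply, b.apply_append_sec, a.apply_append_sec, mul_apply] at h
    exact (List.append_cancel_left h).symm

@[simp]
theorem one_sec (v : List X) : (1 : TreeAut X).sec v = 1 :=
  ext_apply fun u => by
    have h := (1 : TreeAut X).apply_append_sec v u
    exact (List.append_cancel_left h).symm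

theorem inv_sec (a : TreeAut X) (v : List X) : (a⁻¹).sec v = (a.sec ((a⁻¹).1 v))⁻¹ := by
  rw [eq_inv_iff_mul_eq_one]
  have h := mul_sec (a⁻¹) a ((a⁻¹).1 v)
  simpa using h.symm

@[simp]
theorem letter_mul (a b : TreeAut X) (x : X) : (a * b).letter x = a.letter (b.letter x) := by
  have h : (a * b).1 [x] = a.1 (b.1 [x]) := rfl
  rw [apply_singleton, apply_singleton, apply_singleton] at h
  exact (List.cons.inj h).1

@[simp]
theorem letter_one (x : X) : (1 : TreeAut X).letter x = x := by
  have h : (1 : TreeAut X).1 [x] = [x] := rfl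
  rw [apply_singleton] at h
  exact (List.cons.inj h).1

@[simp]
theorem letter_inv_letter (a : TreeAut X) (x : X) : (a⁻¹).letter (a.letter x) = x := by
  rw [← letter_mul, inv_mul_cancel, letter_one]

@[simp]
theorem letter_letter_inv (a : TreeAut X) (x : X) : a.letter ((a⁻¹).letter x) = x := by
  rw [← letter_mul, mul_inv_cancel, letter_one]

/-- The permutation of the first layer induced by a tree automorphism. -/
def letterEquiv (a : TreeAut X) : X ≃ X where
  toFun := a.letter
  invFun := (a⁻¹).letter
  left_inv := letter_inv_letter a
  right_inv := letter_letter_inv a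

theorem letter_injective (a : TreeAut X) : Function.Injective a.letter :=
  a.letterEquiv.injective

theorem mul_sec_singleton (a b : TreeAut X) (x : X) :
    (a * b).sec [x] = a.sec [b.letter x] * b.sec [x] := by
  rw [mul_sec, apply_singleton]

theorem inv_sec_singleton (a : TreeAut X) (x : X) :
    (a⁻¹).sec [x] = (a.sec [(a⁻¹).letter x])⁻¹ := by
  rw [inv_sec, apply_singleton]

theorem ext_letter {a b : TreeAut X} (h₁ : ∀ x, a.letter x = b.letter x)
    (h₂ : ∀ x, a.sec [x] = b.sec [x]) : a = b :=
  ext_apply fun u => by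
    cases u with
    | nil => simp
    | cons x u => rw [apply_cons, apply_cons, h₁, h₂]

@[simp]
theorem letter_branchHom (f : X → TreeAut X) (x : X) : (branchHom X f).letter x = x := by
  have h : (branchHom X f).1 [x] = x :: (f x).1 [] := rfl
  simpa [apply_singleton] using h

@[simp]
theorem sec_branchHom (f : X → TreeAut X) (x : X) : (branchHom X f).sec [x] = f x :=
  ext_apply fun u => by
    have h : (branchHom X f).1 (x :: u) = x :: (f x).1 u := rfl
    rw [apply_cons] at h
    exact (List.cons.inj h).2

@[simp]
theorem letter_rootedHom (σ : Equiv.Perm X) (x : X) : (rootedHom X σ).letter x = σ x := by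
  have h : (rootedHom X σ).1 [x] = [σ x] := rfl
  simpa [apply_singleton] using h

@[simp]
theorem sec_rootedHom (σ : Equiv.Perm X) (x : X) : (rootedHom X σ).sec [x] = 1 :=
  ext_apply fun u => by
    have h : (rootedHom X σ).1 (x :: u) = σ x :: u := rfl
    rw [apply_cons] at h
    exact (List.cons.inj h).2

theorem branchHom_sec {a : TreeAut X} (h : ∀ x, a.letter x = x) :
    branchHom X (fun x => a.sec [x]) = a :=
  ext_letter (by simp [h]) (by simp)

/-! ### Geometric powers and automorphisms supported below one vertex. -/

theorem mem_geometricPower {K : Subgroup (TreeAut X)} {a : TreeAut X} :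
    a ∈ geometricPower K ↔ ∀ x, a.letter x = x ∧ a.sec [x] ∈ K := by
  constructor
  · rintro ⟨f, hf, rfl⟩ x
    exact ⟨by simp, by simpa using hf x (Set.mem_univ x)⟩
  · intro h
    exact ⟨fun x => a.sec [x], fun x _ => (h x).2, branchHom_sec fun x => (h x).1⟩

theorem branchHom_injective : Function.Injective (branchHom X) := fun f g h =>
  funext fun x => by rw [← sec_branchHom f x, h, sec_branchHom]

open Classical in
/-- The automorphism `rigid v k` acts as `k` on the subtree below the vertex `v` and fixes all
words not below `v`. -/
noncomputable def rigid : List X → TreeAut X →* TreeAut X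
  | [] => MonoidHom.id _
  | x :: v => (branchHom X).comp ((MonoidHom.mulSingle (fun _ : X => TreeAut X) x).comp (rigid v))

@[simp]
theorem rigid_nil (k : TreeAut X) : rigid [] k = k := rfl

theorem rigid_cons (x : X) (v : List X) (k : TreeAut X) :
    rigid (x :: v) k = rigid [x] (rigid v k) := rfl

@[simp]
theorem letter_rigid (x : X) (k : TreeAut X) (y : X) : (rigid [x] k).letter y = y :=
  letter_branchHom _ _

@[simp]
theorem sec_rigid_self (x : X) (k : TreeAut X) : (rigid [x] k).sec [x] = k := by
  simp [rigid]

theorem sec_rigid_of_ne {x y : X} (h : y ≠ x) (k : TreeAut X) : (rigid [x] k).sec [y] = 1 := by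
  simp [rigid, h]

theorem mul_rigid_singleton (a : TreeAut X) (x : X) (k : TreeAut X) :
    a * rigid [x] k * a⁻¹ = rigid [a.letter x] (a.sec [x] * k * (a.sec [x])⁻¹) := by
  rw [mul_inv_eq_iff_eq_mul]
  refine ext_letter (by simp) fun y => ?_
  rw [mul_sec_singleton, mul_sec_singleton, letter_rigid]
  by_cases h : y = x
  · subst h
    rw [sec_rigid_self, sec_rigid_self, inv_mul_cancel_right]
  · rw [sec_rigid_of_ne h, sec_rigid_of_ne (fun h' => h (a.letter_injective h'))]
    simp

theorem mul_rigid (a : TreeAut X) (v : List X) (k : TreeAut X) :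
    a * rigid v k * a⁻¹ = rigid (a.1 v) (a.sec v * k * (a.sec v)⁻¹) := by
  induction v generalizing a with
  | nil => simp
  | cons x v ih =>
    rw [rigid_cons x v, mul_rigid_singleton, ih, apply_cons, sec_cons a x v, ← rigid_cons]

@[simp]
theorem sec_rigid (v : List X) (k : TreeAut X) : (rigid v k).sec v = k := by
  induction v with
  | nil => simp
  | cons x v ih => rw [rigid_cons, sec_cons, sec_rigid_self, ih]

theorem rigid_mem {K : Subgroup (TreeAut X)} (hK : geometricPower K ≤ K) {k : TreeAut X}
    (hk : k ∈ K) (v : List X) : rigid v k ∈ K := by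
  induction v with
  | nil => exact hk
  | cons x v ih =>
    rw [rigid_cons]
    refine hK (mem_geometricPower.2 fun y => ⟨by simp, ?_⟩)
    by_cases h : y = x
    · subst h; simpa using ih
    · rw [sec_rigid_of_ne h]; exact K.one_mem

/-- Over a finite alphabet, `ψ f` is a product of its single-coordinate factors. -/
theorem geometricPower_le [Finite X] {K J : Subgroup (TreeAut X)}
    (h : ∀ x, ∀ k ∈ K, rigid [x] k ∈ J) : geometricPower K ≤ J := by
  classical
  rw [geometricPower, Subgroup.map_le_iff_le_comap, Subgroup.pi_le_iff]
  rintro x _ ⟨k, hk, rfl⟩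
  rw [Subgroup.mem_comap]
  convert h x k hk using 1
  simp only [rigid, MonoidHom.comp_apply, MonoidHom.id_apply]

theorem geometricPower_iterate_le [Finite X] {K J : Subgroup (TreeAut X)} (n : ℕ)
    (h : ∀ v : List X, v.length = n → ∀ k ∈ K, rigid v k ∈ J) : geometricPower^[n] K ≤ J := by
  induction n generalizing J with
  | zero => exact fun k hk => h [] rfl k hk
  | succ n ih =>
    rw [Function.iterate_succ_apply']
    refine geometricPower_le fun x k hk => ?_
    have : geometricPower^[n] K ≤ J.comap (rigid [x]) := ih fun v hv k hk => by
      rw [Subgroup.mem_comap, ← rigid_cons]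
      exact h _ (by simp [hv]) k hk
    exact this hk

theorem geometricPower_mono {K J : Subgroup (TreeAut X)} (h : K ≤ J) :
    geometricPower K ≤ geometricPower J := fun _ ha =>
  mem_geometricPower.2 fun x =>
    ⟨(mem_geometricPower.1 ha x).1, h (mem_geometricPower.1 ha x).2⟩

theorem geometricPower_isFiniteRelIndex [Finite X] {K J : Subgroup (TreeAut X)}
    (h : K.IsFiniteRelIndex J) : (geometricPower K).IsFiniteRelIndex (geometricPower J) := by
  rw [Subgroup.isFiniteRelIndex_iff_relIndex_ne_zero] at h ⊢
  -- The power is a finite intersection of coordinate pullbacks, so finiteness of the index can be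
  -- checked one letter at a time.
  have hinf : (Subgroup.pi Set.univ fun _ : X => K) =
      ⨅ x : X, K.comap (Pi.evalMonoidHom (fun _ : X => TreeAut X) x) := by
    ext f
    simp [Subgroup.mem_pi, Subgroup.mem_iInf]
  rw [geometricPower, geometricPower, Subgroup.relIndex_map_map_of_injective _ _ branchHom_injective,
    hinf]
  refine Subgroup.relIndex_iInf_ne_zero fun x => ?_
  rw [Subgroup.relIndex_comap]
  refine mt (Subgroup.relIndex_eq_zero_of_le_right ?_) h
  rintro _ ⟨f, hf, rfl⟩
  exact hf x (Set.mem_univ x)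

theorem geometricPower_iterate_isFiniteRelIndex [Finite X] {K : Subgroup (TreeAut X)}
    (hK : geometricPower K ≤ K) (h : (geometricPower K).IsFiniteRelIndex K) (n : ℕ) :
    (geometricPower^[n] K).IsFiniteRelIndex K := by
  induction n with
  | zero => simp [Subgroup.isFiniteRelIndex_iff_relIndex_ne_zero]
  | succ n ih =>
    rw [Function.iterate_succ_apply']
    have h1 := geometricPower_isFiniteRelIndex ih
    rw [Subgroup.isFiniteRelIndex_iff_relIndex_ne_zero] at *
    have hle : geometricPower (geometricPower^[n] K) ≤ geometricPower K := by
      refine geometricPower_mono (geometricPower_iterate_le n fun v _ k hk => ?_)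
      exact rigid_mem hK hk v
    rw [← Subgroup.relIndex_mul_relIndex _ _ _ hle hK]
    exact mul_ne_zero h1 h

end Basic

end TreeAut

/-! ### Words in rooted and directed letters, and their contraction under sections. -/

section SpinalWords

open TreeAut

variable {R : Type*} [Group R]

/-- The rooted automorphism given by left multiplication by a group element. -/
def rootedMul (R : Type*) [Group R] : R →* TreeAut R :=
  (rootedHom R).comp (MulAction.toPermHom R R)

@[simp]
theorem letter_rootedMul (r x : R) : (rootedMul R r).letter x = r * x := by
  simp [rootedMul]

@[simp]
theorem sec_rootedMul (r x : R) : (rootedMul R r).sec [x] = 1 := by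
  simp [rootedMul]

@[simp]
theorem letter_rootedMul_inv (r x : R) : ((rootedMul R r)⁻¹).letter x = r⁻¹ * x := by
  rw [← map_inv, letter_rootedMul]

@[simp]
theorem sec_rootedMul_inv (r x : R) : ((rootedMul R r)⁻¹).sec [x] = 1 := by
  rw [← map_inv, sec_rootedMul]

theorem mem_rootedGroup {a : TreeAut R} : a ∈ rootedGroup R ↔ ∃ r, rootedMul R r = a := Iff.rfl

theorem rootedMul_mem_rootedGroup (r : R) : rootedMul R r ∈ rootedGroup R := ⟨r, rfl⟩

theorem rootedMul_mem_spinalGroup (D : Subgroup (TreeAut R)) (r : R) :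
    rootedMul R r ∈ spinalGroup D :=
  Subgroup.subset_closure (Or.inl (rootedMul_mem_rootedGroup r))

theorem rootedGroup_le_spinalGroup (D : Subgroup (TreeAut R)) : rootedGroup R ≤ spinalGroup D :=
  fun _ h => Subgroup.subset_closure (Or.inl h)

theorem le_spinalGroup (D : Subgroup (TreeAut R)) : D ≤ spinalGroup D :=
  fun _ h => Subgroup.subset_closure (Or.inr h)

theorem spinalGroup_le {D M : Subgroup (TreeAut R)} (h₁ : rootedGroup R ≤ M) (h₂ : D ≤ M) :
    spinalGroup D ≤ M :=
  (Subgroup.closure_le _).2 (Set.union_subset h₁ h₂)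

theorem spinalGroup_mono {D E : Subgroup (TreeAut R)} (h : D ≤ E) :
    spinalGroup D ≤ spinalGroup E :=
  spinalGroup_le (rootedGroup_le_spinalGroup E) (h.trans (le_spinalGroup E))

theorem IsDirectedAut.letter {d : TreeAut R} (h : IsDirectedAut d) (x : R) : d.letter x = x := by
  have := h.fix x
  rw [apply_singleton] at this
  exact (List.cons.inj this).1

/-- `SpinalWord D n g a` says that `g` is a product of rooted automorphisms and of `n` elements
of `D`, where `a` is the product of the latter in the abelianization of `D`. -/
inductive SpinalWord (D : Subgroup (TreeAut R)) : ℕ → TreeAut R → Abelianization D → Prop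
  | one : SpinalWord D 0 1 1
  | rotate (r : R) {n : ℕ} {g : TreeAut R} {a : Abelianization D} (h : SpinalWord D n g a) :
      SpinalWord D n (rootedMul R r * g) a
  | direct (d : D) {n : ℕ} {g : TreeAut R} {a : Abelianization D} (h : SpinalWord D n g a) :
      SpinalWord D (n + 1) (d * g) (Abelianization.of d * a)

theorem Fintype.le_of_sum_eq {ι : Type*} [Fintype ι] {m : ι → ℕ} {n : ℕ}
    (hm : ∑ x, m x = n) (x : ι) : m x ≤ n :=
  hm ▸ Finset.single_le_sum (fun y _ => Nat.zero_le (m y)) (Finset.mem_univ x)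

namespace SpinalWord

variable {D : Subgroup (TreeAut R)} {m n : ℕ} {g h : TreeAut R} {a b : Abelianization D}

theorem mul (hg : SpinalWord D m g a) (hh : SpinalWord D n h b) :
    SpinalWord D (m + n) (g * h) (a * b) := by
  induction hg with
  | one => simpa using hh
  | rotate r _ ih => rw [mul_assoc]; exact ih.rotate r
  | direct d _ ih =>
    rw [mul_assoc, mul_assoc, Nat.add_right_comm]; exact ih.direct d

theorem of_rooted (hg : g ∈ rootedGroup R) : SpinalWord D 0 g 1 := by
  obtain ⟨r, rfl⟩ := mem_rootedGroup.1 hg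
  simpa using one.rotate (D := D) r

theorem of_mem (d : D) : SpinalWord D 1 d (Abelianization.of d) := by
  simpa using one.direct d

theorem inv (hg : SpinalWord D n g a) : SpinalWord D n g⁻¹ a⁻¹ := by
  induction hg with
  | one => simpa using one
  | rotate r _ ih =>
    simpa using ih.mul (of_rooted (rootedGroup R |>.inv_mem (rootedMul_mem_rootedGroup r)))
  | direct d _ ih =>
    simpa [mul_comm] using ih.mul (of_mem d⁻¹)

theorem mem_spinalGroup (hg : SpinalWord D n g a) : g ∈ spinalGroup D := by
  induction hg with
  | one => exact one_mem _
  | rotate r _ ih => exact mul_mem (rootedMul_mem_spinalGroup D r) ih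
  | direct d _ ih => exact mul_mem (le_spinalGroup D d.2) ih

theorem exists_of_mem (hg : g ∈ spinalGroup D) : ∃ n a, SpinalWord D n g a := by
  refine Subgroup.closure_induction ?_ ⟨_, _, one⟩ ?_ ?_ hg
  · rintro x (hx | hx)
    · exact ⟨_, _, of_rooted hx⟩
    · exact ⟨_, _, of_mem ⟨x, hx⟩⟩
  · rintro x y _ _ ⟨m, a, hx⟩ ⟨n, b, hy⟩
    exact ⟨_, _, hx.mul hy⟩
  · rintro x _ ⟨m, a, hx⟩
    exact ⟨_, _, hx.inv⟩

theorem letter (hD : ∀ d ∈ D, IsDirectedAut d) (hg : SpinalWord D n g a) (x : R) :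
    g.letter x = g.letter 1 * x := by
  induction hg with
  | one => simp
  | rotate r _ ih => simp [ih, mul_assoc]
  | direct d _ ih => simp [(hD d d.2).letter, ih]

/-- A directed letter reappears as itself in exactly one section and contributes rooted letters to
all others; hence lengths add up to `n` and classes multiply to `a`. If one section receives every
directed letter, it receives no rooted one, so it lies in `D`. This last clause handles the case
where the length does not drop. -/
theorem exists_sections [Fintype R] (hD : ∀ d ∈ D, IsDirectedAut d) (hg : SpinalWord D n g a) :
    ∃ (m : R → ℕ) (b : R → Abelianization D), ∑ x, m x = n ∧ ∏ x, b x = a ∧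
      ∀ x, SpinalWord D (m x) (g.sec [x]) (b x) ∧
        (m x = n → ∃ hd : g.sec [x] ∈ D, b x = Abelianization.of ⟨_, hd⟩) := by
  classical
  induction hg with
  | one =>
    refine ⟨fun _ => 0, fun _ => 1, by simp, by simp, fun x => ?_⟩
    rw [one_sec]
    exact ⟨one, fun _ => ⟨one_mem _, (map_one _).symm⟩⟩
  | rotate r _ ih =>
    obtain ⟨m, b, hm, hb, h⟩ := ih
    refine ⟨m, b, hm, hb, fun x => ?_⟩
    rw [mul_sec_singleton, sec_rootedMul, one_mul]
    exact h x
  | @direct d n g a _ ih =>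
    obtain ⟨m, b, hm, hb, h⟩ := ih
    -- The new letter `d` survives precisely at the letter that `g` sends to `1`.
    refine ⟨fun x => m x + (Pi.single ((g⁻¹).letter 1) 1 : R → ℕ) x,
      fun x => (Pi.mulSingle ((g⁻¹).letter 1) (Abelianization.of d) : R → Abelianization D) x * b x, ?_, ?_, fun x => ?_⟩
    · rw [Finset.sum_add_distrib, hm, Finset.sum_pi_single']; simp
    · rw [Finset.prod_mul_distrib, hb, Finset.prod_pi_mulSingle']; simp
    · rw [mul_sec_singleton]
      by_cases hx : x = (g⁻¹).letter 1
      · subst hx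
        simp only [letter_letter_inv, Pi.single_eq_same, Pi.mulSingle_eq_same,
          (hD d d.2).sec_one]
        refine ⟨(h _).1.direct d, fun hmn => ?_⟩
        obtain ⟨hd, hb'⟩ := (h _).2 (Nat.succ.inj hmn)
        refine ⟨mul_mem d.2 hd, ?_⟩
        rw [hb', ← map_mul]
        rfl
      · simp only [Pi.single_eq_of_ne hx, Pi.mulSingle_eq_of_ne hx]
        have hx' : g.letter x ≠ 1 := fun h' => hx (by rw [← h', letter_inv_letter])
        refine ⟨?_, fun hmn => absurd (Fintype.le_of_sum_eq hm x) (by omega)⟩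
        simpa using (of_rooted ((hD d d.2).sec_ne_one _ hx')).mul (h x).1

/-- All sections of `1` are `1`. Each is written by a shorter word, or by a word of full length
whose class is that of the section itself, an element of `D`. -/
theorem eq_one [Finite R] (hD : ∀ d ∈ D, IsDirectedAut d) (h : SpinalWord D n 1 a) : a = 1 := by
  have := Fintype.ofFinite R
  induction n using Nat.strong_induction_on generalizing a with
  | _ n ih =>
    obtain ⟨m, b, hm, hb, h'⟩ := h.exists_sections hD
    rw [← hb]
    refine Finset.prod_eq_one fun x _ => ?_
    obtain ⟨h1, h2⟩ := h' x
    rcases (Fintype.le_of_sum_eq hm x).lt_or_eq with hlt | heq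
    · rw [one_sec] at h1
      exact ih _ hlt h1
    · obtain ⟨hd, hb⟩ := h2 heq
      rw [hb, ← map_one Abelianization.of]
      exact congrArg _ (Subtype.ext (one_sec _))

theorem unique [Finite R] (hD : ∀ d ∈ D, IsDirectedAut d) (h₁ : SpinalWord D m g a)
    (h₂ : SpinalWord D n g b) : a = b := by
  have := h₁.mul h₂.inv
  rw [mul_inv_cancel] at this
  exact mul_inv_eq_one.1 (this.eq_one hD)

theorem mem_of_isDirectedAut [Finite R] (hD : ∀ d ∈ D, IsDirectedAut d) (h : SpinalWord D n g a)
    (hg : g.sec [1] = g) : g ∈ D := by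
  have := Fintype.ofFinite R
  induction n using Nat.strong_induction_on generalizing a with
  | _ n ih =>
    obtain ⟨m, b, hm, hb, h'⟩ := h.exists_sections hD
    obtain ⟨h1, h2⟩ := h' 1
    rw [hg] at h1 h2
    rcases (Fintype.le_of_sum_eq hm 1).lt_or_eq with hlt | heq
    · exact ih _ hlt h1
    · exact (h2 heq).1

end SpinalWord

/-! ### Self-similarity of spinal groups and the map to the abelianization of the directed group. -/

section

variable {D : Subgroup (TreeAut R)} {g : TreeAut R}

theorem mem_of_mem_spinalGroup [Finite R] (hD : ∀ d ∈ D, IsDirectedAut d)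
    (hg : g ∈ spinalGroup D) (hg' : g.sec [1] = g) : g ∈ D := by
  obtain ⟨n, a, h⟩ := SpinalWord.exists_of_mem hg
  exact h.mem_of_isDirectedAut hD hg'

theorem letter_of_mem_spinalGroup (hD : ∀ d ∈ D, IsDirectedAut d) (hg : g ∈ spinalGroup D)
    (x : R) : g.letter x = g.letter 1 * x := by
  obtain ⟨n, a, h⟩ := SpinalWord.exists_of_mem hg
  exact h.letter hD x

theorem sec_singleton_mem_spinalGroup [Finite R] (hD : ∀ d ∈ D, IsDirectedAut d)
    (hg : g ∈ spinalGroup D) (x : R) : g.sec [x] ∈ spinalGroup D := by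
  have := Fintype.ofFinite R
  obtain ⟨n, a, h⟩ := SpinalWord.exists_of_mem hg
  obtain ⟨m, b, -, -, h⟩ := h.exists_sections hD
  exact (h x).1.mem_spinalGroup

theorem sec_mem_spinalGroup [Finite R] (hD : ∀ d ∈ D, IsDirectedAut d)
    (hg : g ∈ spinalGroup D) (v : List R) : g.sec v ∈ spinalGroup D := by
  induction v generalizing g with
  | nil => simpa using hg
  | cons x v ih =>
    rw [sec_cons]
    exact ih (sec_singleton_mem_spinalGroup hD hg x)

theorem sec_mem_of_mem_or (hD : ∀ d ∈ D, IsDirectedAut d) (hg : g ∈ D ∨ g ∈ rootedGroup R)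
    (v : List R) : g.sec v ∈ D ∨ g.sec v ∈ rootedGroup R := by
  induction v generalizing g with
  | nil => simpa using hg
  | cons x v ih =>
    rw [sec_cons]
    refine ih ?_
    rcases hg with hg | hg
    · by_cases hx : x = 1
      · subst hx; rw [(hD g hg).sec_one]; exact Or.inl hg
      · exact Or.inr ((hD g hg).sec_ne_one x hx)
    · obtain ⟨r, rfl⟩ := mem_rootedGroup.1 hg
      rw [sec_rootedMul]
      exact Or.inl D.one_mem

/-- The sections at a sufficiently deep layer are rooted or directed. -/
theorem exists_layer_sec_mem [Finite R] (hD : ∀ d ∈ D, IsDirectedAut d)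
    (hg : g ∈ spinalGroup D) :
    ∃ k, ∀ v : List R, k ≤ v.length → g.sec v ∈ D ∨ g.sec v ∈ rootedGroup R := by
  have := Fintype.ofFinite R
  obtain ⟨n, a, h⟩ := SpinalWord.exists_of_mem hg
  clear hg
  induction n using Nat.strong_induction_on generalizing g a with
  | _ n ih =>
    obtain ⟨m, b, hm, hb, h'⟩ := h.exists_sections hD
    have key : ∀ x, ∃ k, ∀ v : List R, k ≤ v.length →
        (g.sec [x]).sec v ∈ D ∨ (g.sec [x]).sec v ∈ rootedGroup R := fun x => by
      obtain ⟨h1, h2⟩ := h' x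
      rcases (Fintype.le_of_sum_eq hm x).lt_or_eq with hlt | heq
      · exact ih _ hlt _ h1
      · exact ⟨0, fun v _ => sec_mem_of_mem_or hD (Or.inl (h2 heq).1) v⟩
    choose k hk using key
    refine ⟨(Finset.univ.sup k) + 1, fun v hv => ?_⟩
    cases v with
    | nil => simp at hv
    | cons x v =>
      rw [sec_cons]
      refine hk x v ((Finset.le_sup (Finset.mem_univ x)).trans ?_)
      simpa using hv

/-- The homomorphism from a spinal group to the abelianization of its directed group that kills
the rooted automorphisms. -/
noncomputable def spinalAb [Finite R] (hD : ∀ d ∈ D, IsDirectedAut d) :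
    spinalGroup D →* Abelianization D where
  toFun g := (SpinalWord.exists_of_mem g.2).choose_spec.choose
  map_one' := (SpinalWord.exists_of_mem (one_mem _)).choose_spec.choose_spec.eq_one hD
  map_mul' g h := (SpinalWord.exists_of_mem (mul_mem g.2 h.2)).choose_spec.choose_spec.unique hD
    ((SpinalWord.exists_of_mem g.2).choose_spec.choose_spec.mul
      (SpinalWord.exists_of_mem h.2).choose_spec.choose_spec)

theorem SpinalWord.spinalAb_eq [Finite R] (hD : ∀ d ∈ D, IsDirectedAut d) {n : ℕ}
    {a : Abelianization D} (h : SpinalWord D n g a) (hg : g ∈ spinalGroup D) :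
    spinalAb hD ⟨g, hg⟩ = a :=
  (SpinalWord.exists_of_mem hg).choose_spec.choose_spec.unique hD h

theorem spinalAb_of_mem [Finite R] (hD : ∀ d ∈ D, IsDirectedAut d) (d : D) :
    spinalAb hD ⟨d, le_spinalGroup D d.2⟩ = Abelianization.of d :=
  (SpinalWord.of_mem d).spinalAb_eq hD _

theorem spinalAb_of_rooted [Finite R] (hD : ∀ d ∈ D, IsDirectedAut d) (hg : g ∈ rootedGroup R) :
    spinalAb hD ⟨g, rootedGroup_le_spinalGroup D hg⟩ = 1 :=
  (SpinalWord.of_rooted hg).spinalAb_eq hD _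

theorem spinalAb_eq_prod [Fintype R] (hD : ∀ d ∈ D, IsDirectedAut d) (g : spinalGroup D) :
    spinalAb hD g =
      ∏ x, spinalAb hD ⟨g.1.sec [x], sec_singleton_mem_spinalGroup hD g.2 x⟩ := by
  obtain ⟨n, a, h⟩ := SpinalWord.exists_of_mem g.2
  obtain ⟨m, b, -, hb, h'⟩ := h.exists_sections hD
  rw [h.spinalAb_eq hD g.2, ← hb]
  exact Finset.prod_congr rfl fun x _ => ((h' x).1.spinalAb_eq hD _).symm

/-- The abelianization homomorphism of a spinal group extends to the group of all automorphisms
whose sections at a given layer lie in the spinal group. -/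
theorem exists_spinalAb_extension [Finite R] (hD : ∀ d ∈ D, IsDirectedAut d) (n : ℕ) :
    ∃ (Q : Subgroup (TreeAut R)) (f : Q →* Abelianization D),
      (∀ a, a ∈ Q ↔ ∀ v : List R, v.length = n → a.sec v ∈ spinalGroup D) ∧
      ∀ a (ha : a ∈ spinalGroup D) (ha' : a ∈ Q), f ⟨a, ha'⟩ = spinalAb hD ⟨a, ha⟩ := by
  have := Fintype.ofFinite R
  induction n with
  | zero =>
    refine ⟨spinalGroup D, spinalAb hD, fun a => ⟨fun h v hv => ?_, fun h => ?_⟩, fun _ _ _ => rfl⟩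
    · rw [List.length_eq_zero_iff.1 hv, sec_nil]; exact h
    · simpa using h [] rfl
  | succ n ih =>
    obtain ⟨Q, f, hQ, hf⟩ := ih
    let Q' : Subgroup (TreeAut R) :=
      { carrier := {a | ∀ x, a.sec [x] ∈ Q}
        one_mem' := fun x => by simp [one_mem]
        mul_mem' := fun {a b} ha hb x => by
          rw [mul_sec_singleton]; exact mul_mem (ha _) (hb _)
        inv_mem' := fun {a} ha x => by
          rw [inv_sec_singleton]; exact inv_mem (ha _) }
    let f' : Q' →* Abelianization D :=
      { toFun := fun a => ∏ x, f ⟨a.1.sec [x], a.2 x⟩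
        map_one' := Finset.prod_eq_one fun x _ => by
          rw [← map_one f]; exact congrArg _ (Subtype.ext (one_sec _))
        map_mul' := fun a b => by
          -- The section of `a * b` at `x` involves `a` at the letter `b(x)`, so the product for `a`
          -- is reindexed along `b`; commutativity of the target is what permits this.
          rw [← Equiv.prod_comp b.1.letterEquiv fun x => f ⟨a.1.sec [x], a.2 x⟩,
            ← Finset.prod_mul_distrib]
          refine Finset.prod_congr rfl fun x _ => ?_
          rw [← map_mul]
          congr 1
          exact Subtype.ext (mul_sec_singleton _ _ _) }
    refine ⟨Q', f', fun a => ⟨fun h v hv => ?_, fun h x => ?_⟩, fun a ha ha' => ?_⟩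
    · cases v with
      | nil => simp at hv
      | cons x v =>
        rw [sec_cons]
        exact (hQ _).1 (h x) v (by simpa using hv)
    · refine (hQ _).2 fun v hv => ?_
      rw [← sec_cons]
      exact h _ (by simp [hv])
    · rw [spinalAb_eq_prod]
      exact Finset.prod_congr rfl fun x _ => hf _ _ _

end

end SpinalWords

/-! ### Commutator subgroups of subgroups of an ambient group. -/

section Commutators

open TreeAut
open scoped commutatorElement

theorem Subgroup.map_mem_commutator {A B : Type*} [Group A] [Group B] {G : Subgroup A}
    {K : Subgroup B} (f : G →* B) (hf : ∀ g, f g ∈ K) {g : A} (hg : g ∈ ⁅G, G⁆) (hg' : g ∈ G) :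
    f ⟨g, hg'⟩ ∈ ⁅K, K⁆ := by
  have : ⁅G, G⁆ ≤ (⁅K, K⁆.comap f).map G.subtype := by
    rw [Subgroup.commutator_le]
    intro a ha b hb
    refine ⟨⁅(⟨a, ha⟩ : G), ⟨b, hb⟩⁆, ?_, rfl⟩
    rw [SetLike.mem_coe, Subgroup.mem_comap, map_commutatorElement]
    exact Subgroup.commutator_mem_commutator (hf _) (hf _)
  obtain ⟨x, hx, rfl⟩ := this hg
  exact hx

theorem Subgroup.mem_commutator_of_abelianization_eq_one {A : Type*} [Group A] {G : Subgroup A}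
    {g : G} (h : Abelianization.of g = 1) : (g : A) ∈ ⁅G, G⁆ := by
  have hg : g ∈ (Abelianization.of (G := G)).ker := h
  rw [Abelianization.ker_of] at hg
  rw [← Subgroup.map_subtype_commutator]
  exact ⟨g, hg, rfl⟩

theorem Subgroup.commutator_self_le {A : Type*} [Group A] (G : Subgroup A) : ⁅G, G⁆ ≤ G := by
  rw [Subgroup.commutator_le]
  intro a ha b hb
  exact mul_mem (mul_mem (mul_mem ha hb) (inv_mem ha)) (inv_mem hb)

theorem Subgroup.conj_mem_commutator_self {A : Type*} [Group A] {G : Subgroup A} {g k : A}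
    (hg : g ∈ G) (hk : k ∈ ⁅G, G⁆) : g * k * g⁻¹ ∈ ⁅G, G⁆ := by
  have h := mul_mem (Subgroup.commutator_mem_commutator hg (G.commutator_self_le hk)) hk
  rwa [commutatorElement_def, inv_mul_cancel_right] at h

end Commutators

/-! ### First-section groups, and commutators in spinal groups. -/

section Spinal

open TreeAut
open scoped commutatorElement

variable {R : Type*} [Group R] {D T M : Subgroup (TreeAut R)} {g k s : TreeAut R}

/-- The group of all sections at the letter `1` of the elements of `M` which fix this letter. -/
def firstSec (M : Subgroup (TreeAut R)) : Subgroup (TreeAut R) where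
  carrier := {a | ∃ m ∈ M, m.letter 1 = 1 ∧ m.sec [1] = a}
  one_mem' := ⟨1, one_mem _, by simp, by simp⟩
  mul_mem' := by
    rintro _ _ ⟨a, ha, ha', rfl⟩ ⟨b, hb, hb', rfl⟩
    exact ⟨a * b, mul_mem ha hb, by simp [ha', hb'], by rw [mul_sec_singleton, hb']⟩
  inv_mem' := by
    rintro _ ⟨a, ha, ha', rfl⟩
    have h : (a⁻¹).letter 1 = 1 := by
      conv_lhs => rw [← ha']
      simp
    exact ⟨a⁻¹, inv_mem ha, h, by rw [inv_sec_singleton, h]⟩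

theorem sec_mem_firstSec (hM : rootedGroup R ≤ M) (hg : g ∈ M) (x : R) :
    g.sec [x] ∈ firstSec M := by
  refine ⟨rootedMul R (g.letter x)⁻¹ * g * rootedMul R x,
    mul_mem (mul_mem (hM (rootedMul_mem_rootedGroup _)) hg) (hM (rootedMul_mem_rootedGroup _)),
    by simp, by simp [mul_sec_singleton]⟩

theorem exists_sec_eq_of_mem_firstSec (hM : rootedGroup R ≤ M) (hg : g ∈ firstSec M) (x : R) :
    ∃ m ∈ M, m.letter x = x ∧ m.sec [x] = g := by
  obtain ⟨m, hm, h1, rfl⟩ := hg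
  exact ⟨rootedMul R x * m * rootedMul R x⁻¹,
    mul_mem (mul_mem (hM (rootedMul_mem_rootedGroup _)) hm) (hM (rootedMul_mem_rootedGroup _)),
    by simp [h1], by simp [mul_sec_singleton]⟩

/-- Self-replication: the labels of `D` generate `R`, and each `d` is its own section at `1`. -/
theorem IsDirectedGroup.spinalGroup_le_firstSec (hD : IsDirectedGroup D)
    (hM : spinalGroup D ≤ M) : spinalGroup D ≤ firstSec M := by
  have hR := (rootedGroup_le_spinalGroup D).trans hM
  refine spinalGroup_le ?_ fun d hd => ?_
  · rw [← hD.generates, Subgroup.closure_le]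
    rintro _ ⟨d, hd, x, -, rfl⟩
    exact sec_mem_firstSec hR (hM (le_spinalGroup D hd)) x
  · rw [← (hD.directed d hd).sec_one]
    exact sec_mem_firstSec hR (hM (le_spinalGroup D hd)) 1

theorem IsDirectedGroup.firstSec_le [Finite R] (hD : IsDirectedGroup D)
    (hM : M ≤ spinalGroup D) : firstSec M ≤ spinalGroup D := by
  rintro _ ⟨m, hm, -, rfl⟩
  exact sec_singleton_mem_spinalGroup hD.directed (hM hm) 1

theorem IsDirectedGroup.exists_sec_eq (hD : IsDirectedGroup D) (hs : s ∈ spinalGroup D)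
    (v : List R) : ∃ q ∈ spinalGroup D, q.1 v = v ∧ q.sec v = s := by
  induction v generalizing s with
  | nil => exact ⟨s, hs, by simp, by simp⟩
  | cons x v ih =>
    obtain ⟨q, hq, hq1, hq2⟩ := ih hs
    obtain ⟨p, hp, hp1, hp2⟩ := exists_sec_eq_of_mem_firstSec (rootedGroup_le_spinalGroup D)
      (hD.spinalGroup_le_firstSec le_rfl hq) x
    exact ⟨p, hp, by rw [apply_cons, hp1, hp2, hq1], by rw [sec_cons, hp2, hq2]⟩

/-- If the group generated by the rooted automorphisms and directed automorphisms acts transitively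
on the layers, then the labels of the directed automorphisms generate the rooted group. -/
theorem isDirectedGroup_of_isSphericallyTransitive (hT : ∀ t ∈ T, IsDirectedAut t)
    (h : IsSphericallyTransitive (spinalGroup T)) : IsDirectedGroup T := by
  refine ⟨hT, le_antisymm ?_ ?_⟩
  · rw [Subgroup.closure_le]
    rintro _ ⟨t, ht, x, hx, rfl⟩
    exact (hT t ht).sec_ne_one x hx
  set L := Subgroup.closure {s : TreeAut R | ∃ d ∈ T, ∃ x : R, x ≠ 1 ∧ s = d.sec [x]} with hL
  have hLR : L ≤ rootedGroup R := by
    rw [hL, Subgroup.closure_le]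
    rintro _ ⟨t, ht, x, hx, rfl⟩
    exact (hT t ht).sec_ne_one x hx
  -- First-layer sections only involve labels and elements of `T`, and the latter act trivially on
  -- the next letter.
  have hsec : ∀ s ∈ spinalGroup T, ∀ x, s.sec [x] ∈ L ⊔ T := fun s hs => by
    obtain ⟨n, a, hw⟩ := SpinalWord.exists_of_mem hs
    clear hs
    induction hw with
    | one => intro x; rw [one_sec]; exact one_mem _
    | rotate r _ ih =>
      intro x
      rw [mul_sec_singleton, sec_rootedMul, one_mul]
      exact ih x
    | @direct d n g a _ ih =>
      intro x
      rw [mul_sec_singleton]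
      refine mul_mem ?_ (ih x)
      by_cases hx : g.letter x = 1
      · rw [hx, (hT d d.2).sec_one]
        exact (le_sup_right : T ≤ L ⊔ T) d.2
      · exact (le_sup_left : L ≤ L ⊔ T) (Subgroup.subset_closure ⟨d, d.2, _, hx, rfl⟩)
  have hletter : ∀ s ∈ L ⊔ T, ∃ r, rootedMul R r ∈ L ∧ ∀ x, s.letter x = r * x := fun s hs => by
    rw [Subgroup.sup_eq_closure] at hs
    induction hs using Subgroup.closure_induction with
    | mem s hs =>
      rcases hs with hs | hs
      · obtain ⟨r, rfl⟩ := mem_rootedGroup.1 (hLR hs)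
        exact ⟨r, hs, fun x => by simp⟩
      · exact ⟨1, by rw [map_one]; exact one_mem _, fun x => by rw [(hT s hs).letter, one_mul]⟩
    | one => exact ⟨1, by rw [map_one]; exact one_mem _, fun x => by simp⟩
    | mul a b _ _ iha ihb =>
      obtain ⟨p, hp, hp'⟩ := iha
      obtain ⟨q, hq, hq'⟩ := ihb
      exact ⟨p * q, by rw [map_mul]; exact mul_mem hp hq, fun x => by
        rw [letter_mul, hq', hp', mul_assoc]⟩
    | inv a _ iha =>
      obtain ⟨p, hp, hp'⟩ := iha
      exact ⟨p⁻¹, by rw [map_inv]; exact inv_mem hp, fun x => by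
        rw [eq_inv_mul_iff_mul_eq, ← hp', letter_letter_inv]⟩
  intro a ha
  obtain ⟨r, rfl⟩ := mem_rootedGroup.1 ha
  -- Transitivity on the second layer makes a section at `1` move the letter `1` to `r`, so `r`
  -- comes from `L`.
  obtain ⟨s, hs, hs'⟩ := h [1, 1] [1, r] rfl
  rw [apply_cons, apply_singleton] at hs'
  simp only [List.cons.injEq, and_true] at hs'
  obtain ⟨q, hq, hq'⟩ := hletter _ (hsec s hs 1)
  rw [hq', mul_one] at hs'
  rwa [← hs'.2]

/-- If `d` commutes with a nontrivial rooted `r`, comparing sections at `1` shows that `d` equals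
its own label at `r`. It is then rooted and fixes the first layer, so it is trivial; but trivial
labels cannot generate `R`. -/
theorem IsDirectedGroup.commutator_ne_bot [Nontrivial R] (hD : IsDirectedGroup D) :
    ⁅spinalGroup D, spinalGroup D⁆ ≠ ⊥ := fun h => by
  obtain ⟨r, hr⟩ := exists_ne (1 : R)
  have htriv : ∀ d ∈ D, d = 1 := fun d hd => by
    have hc : d * rootedMul R r = rootedMul R r * d := by
      have := Subgroup.commutator_mem_commutator (le_spinalGroup D hd)
        (rootedMul_mem_spinalGroup D r)
      rw [h, Subgroup.mem_bot, commutatorElement_eq_one_iff_mul_comm] at this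
      exact this
    have h1 := congrArg (fun a => a.sec [1]) hc
    simp only [mul_sec_singleton, letter_rootedMul, sec_rootedMul, mul_one, one_mul,
      (hD.directed d hd).sec_one] at h1
    obtain ⟨q, hq⟩ := mem_rootedGroup.1 ((hD.directed d hd).sec_ne_one r hr)
    rw [h1] at hq
    have h2 := (hD.directed d hd).letter 1
    rw [← hq, letter_rootedMul, mul_one] at h2
    rw [← hq, h2, map_one]
  have hR : rootedGroup R ≤ ⊥ := by
    rw [← hD.generates, Subgroup.closure_le]
    rintro _ ⟨d, hd, x, -, rfl⟩
    rw [htriv d hd, one_sec]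
    exact one_mem _
  have h3 := congrArg (fun a => a.letter 1) (Subgroup.mem_bot.1 (hR (rootedMul_mem_rootedGroup r)))
  simp only [letter_rootedMul, mul_one, letter_one] at h3
  exact hr h3

theorem exists_eq_mul_commutator (hs : s ∈ spinalGroup T) :
    ∃ r, ∃ t : T, ∃ c ∈ ⁅spinalGroup T, spinalGroup T⁆, s = rootedMul R r * t * c := by
  obtain ⟨n, a, hw⟩ := SpinalWord.exists_of_mem hs
  clear hs
  induction hw with
  | one => exact ⟨1, 1, 1, one_mem _, by simp⟩
  | rotate q _ ih =>
    obtain ⟨r, t, c, hc, rfl⟩ := ih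
    exact ⟨q * r, t, c, hc, by simp [mul_assoc]⟩
  | direct d _ ih =>
    obtain ⟨r, t, c, hc, rfl⟩ := ih
    refine ⟨r, d * t, (t : TreeAut R)⁻¹ * ⁅(d : TreeAut R)⁻¹, (rootedMul R r)⁻¹⁆ * (t : TreeAut R)⁻¹⁻¹ * c,
      mul_mem (Subgroup.conj_mem_commutator_self (inv_mem (le_spinalGroup T t.2))
        (Subgroup.commutator_mem_commutator (inv_mem (le_spinalGroup T d.2))
          (inv_mem (rootedMul_mem_spinalGroup T r)))) hc, ?_⟩
    rw [commutatorElement_def, Subgroup.coe_mul]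
    group

/-- The first layer action of a spinal group, as a homomorphism to the rooted automorphisms. -/
def spinalRoot (hD : ∀ d ∈ D, IsDirectedAut d) : spinalGroup D →* TreeAut R where
  toFun g := rootedMul R (g.1.letter 1)
  map_one' := by simp
  map_mul' a b := by
    rw [← map_mul, Subgroup.coe_mul, letter_mul, letter_of_mem_spinalGroup hD a.2]

theorem rootedMul_letter_mem_commutator (hD : ∀ d ∈ D, IsDirectedAut d)
    (hg : g ∈ ⁅spinalGroup D, spinalGroup D⁆) :
    rootedMul R (g.letter 1) ∈ ⁅rootedGroup R, rootedGroup R⁆ :=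
  Subgroup.map_mem_commutator (spinalRoot hD) (fun _ => rootedMul_mem_rootedGroup _) hg
    (Subgroup.commutator_self_le _ hg)

theorem spinalAb_eq_one_of_mem_commutator [Finite R] (hD : ∀ d ∈ D, IsDirectedAut d)
    (hg : g ∈ ⁅spinalGroup D, spinalGroup D⁆) (hg' : g ∈ spinalGroup D) :
    spinalAb hD ⟨g, hg'⟩ = 1 := by
  have h := Subgroup.map_mem_commutator (K := (⊤ : Subgroup (Abelianization D))) (spinalAb hD) (fun _ => Subgroup.mem_top _) hg hg'
  have h' : ⁅(⊤ : Subgroup (Abelianization D)), (⊤ : Subgroup (Abelianization D))⁆ = ⊥ := by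
    rw [Subgroup.commutator_eq_bot_iff_le_centralizer]
    intro a _ b _
    exact mul_comm _ _
  rwa [h', Subgroup.mem_bot] at h

theorem spinalAb_mul_mul [Finite R] (hD : ∀ d ∈ D, IsDirectedAut d) (r : R) (d : D)
    (hk : k ∈ ⁅spinalGroup D, spinalGroup D⁆) (h : rootedMul R r * d * k ∈ spinalGroup D) :
    spinalAb hD ⟨rootedMul R r * d * k, h⟩ = Abelianization.of d := by
  have h1 := spinalAb_of_rooted hD (rootedMul_mem_rootedGroup r)
  have h2 := spinalAb_of_mem hD d
  have h3 := spinalAb_eq_one_of_mem_commutator hD hk (Subgroup.commutator_self_le _ hk)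
  have : (⟨rootedMul R r * d * k, h⟩ : spinalGroup D) =
      ⟨_, rootedGroup_le_spinalGroup D (rootedMul_mem_rootedGroup r)⟩ *
        ⟨d, le_spinalGroup D d.2⟩ * ⟨k, Subgroup.commutator_self_le _ hk⟩ := rfl
  rw [this, map_mul, map_mul, h1, h2, h3, one_mul, mul_one]

theorem rootedMul_mem_commutator_of_letter (hT : ∀ t ∈ T, IsDirectedAut t) {r : R} {t : T}
    (hk : k ∈ ⁅spinalGroup T, spinalGroup T⁆)
    (h : rootedMul R ((rootedMul R r * t * k).letter 1) ∈ ⁅rootedGroup R, rootedGroup R⁆) :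
    rootedMul R r ∈ ⁅rootedGroup R, rootedGroup R⁆ := by
  rw [letter_mul, letter_mul, letter_rootedMul, (hT t t.2).letter, map_mul] at h
  exact (Subgroup.mul_mem_cancel_right _ (rootedMul_letter_mem_commutator hT hk)).1 h

/-- By the normal form `r * t * c`, the class in the abelianization of `T` and the first-layer
action modulo commutators of `R` together detect the commutator subgroup. -/
theorem mem_commutator_of_spinalAb_eq_one [Finite R] (hT : ∀ t ∈ T, IsDirectedAut t)
    (hs : s ∈ spinalGroup T) (h₁ : spinalAb hT ⟨s, hs⟩ = 1)
    (h₂ : rootedMul R (s.letter 1) ∈ ⁅rootedGroup R, rootedGroup R⁆) :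
    s ∈ ⁅spinalGroup T, spinalGroup T⁆ := by
  obtain ⟨r, t, c, hc, rfl⟩ := exists_eq_mul_commutator hs
  rw [spinalAb_mul_mul hT r t hc] at h₁
  have hr := rootedMul_mem_commutator_of_letter hT hc h₂
  have hle := rootedGroup_le_spinalGroup T
  exact mul_mem (mul_mem (Subgroup.commutator_mono hle hle hr)
    (Subgroup.commutator_mono (le_spinalGroup T) (le_spinalGroup T)
      (Subgroup.mem_commutator_of_abelianization_eq_one h₁))) hc

theorem exists_eq_mul_of_mem_commutator [Finite R] (hD : ∀ d ∈ D, IsDirectedAut d) (hTD : T ≤ D)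
    (hs : s ∈ spinalGroup T) (hs' : s ∈ ⁅spinalGroup D, spinalGroup D⁆) :
    ∃ t ∈ T, t ∈ ⁅D, D⁆ ∧ ∃ c ∈ ⁅spinalGroup T, spinalGroup T⁆, s = t * c := by
  have hT : ∀ t ∈ T, IsDirectedAut t := fun t ht => hD t (hTD ht)
  obtain ⟨r, t, c, hc, rfl⟩ := exists_eq_mul_commutator hs
  have hr := rootedMul_mem_commutator_of_letter hT hc (rootedMul_letter_mem_commutator hD hs')
  have hle := rootedGroup_le_spinalGroup T
  have hcD := Subgroup.commutator_mono (spinalGroup_mono hTD) (spinalGroup_mono hTD) hc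
  have h1 := spinalAb_mul_mul hD r ⟨t, hTD t.2⟩ hcD (Subgroup.commutator_self_le _ hs')
  rw [spinalAb_eq_one_of_mem_commutator hD hs'] at h1
  refine ⟨t, t.2, Subgroup.mem_commutator_of_abelianization_eq_one h1.symm,
    (t : TreeAut R)⁻¹ * rootedMul R r * (t : TreeAut R)⁻¹⁻¹ * c,
    mul_mem (Subgroup.conj_mem_commutator_self (inv_mem (le_spinalGroup T t.2))
      (Subgroup.commutator_mono hle hle hr)) hc, ?_⟩
  group

theorem sec_mem_commutator_of_mem_commutator (hD : ∀ d ∈ D, IsDirectedAut d) {d : TreeAut R}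
    (hd : d ∈ ⁅D, D⁆) {x : R} (hx : x ≠ 1) : d.sec [x] ∈ ⁅rootedGroup R, rootedGroup R⁆ := by
  let f : D →* TreeAut R :=
    { toFun := fun d => d.1.sec [x]
      map_one' := one_sec _
      map_mul' := fun a b => by
        rw [Subgroup.coe_mul, mul_sec_singleton, (hD b b.2).letter] }
  exact Subgroup.map_mem_commutator f (fun d => (hD d d.2).sec_ne_one x hx) hd
    (Subgroup.commutator_self_le _ hd)

end Spinal

/-! ### Density, intermediate subgroups, and maximality of `⟨R ∪ T⟩` from that of `T`. -/

section Prodense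

open TreeAut
open scoped commutatorElement

variable {R : Type*} [Group R] {D T M N : Subgroup (TreeAut R)} {g k m : TreeAut R}

theorem IsProdenseIn.exists_mul {A : Type*} [Group A] {G S : Subgroup A} {g : A} (hg : g ∈ G)
    (h : IsProdenseIn (S.map (MulAut.conj g).toMonoidHom) G) (N : Subgroup A) (hNG : N ≤ G)
    (hN : ∀ a ∈ G, ∀ k ∈ N, a * k * a⁻¹ ∈ N) (hN' : N ≠ ⊥) {m : A} (hm : m ∈ G) :
    ∃ s ∈ S, ∃ k ∈ N, m = s * k := by
  have hnorm : (N.subgroupOf G).Normal := ⟨fun n hn a => hN a a.2 n hn⟩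
  have hmem : g * m * g⁻¹ ∈ (G : Set A) := mul_mem (mul_mem hg hm) (inv_mem hg)
  rw [← h.2 N hNG hnorm hN'] at hmem
  obtain ⟨_, ⟨s, hs, rfl⟩, k, hk, hsk⟩ := hmem
  refine ⟨s, hs, g⁻¹ * k * g⁻¹⁻¹, hN _ (inv_mem hg) k hk, ?_⟩
  simp only [MulEquiv.coe_toMonoidHom, MulAut.conj_apply] at hsk
  have : m = g⁻¹ * (g * m * g⁻¹) * g := by group
  rw [this, ← hsk]
  group

/-- `S` meets every coset of every non-trivial normal subgroup of `G`. -/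
def IsNormallyDense {A : Type*} [Group A] (S G : Subgroup A) : Prop :=
  ∀ N : Subgroup A, N ≤ G → (∀ a ∈ G, ∀ k ∈ N, a * k * a⁻¹ ∈ N) → N ≠ ⊥ →
    ∀ m ∈ G, ∃ s ∈ S, ∃ k ∈ N, m = s * k

/-- `N ⊓ G` contains `⁅S, S⁆`, so it is nontrivial and `S` covers `G` modulo it; the quotient is
then an image of an abelian quotient of `S`. -/
theorem IsNormallyDense.commutator_le {A : Type*} [Group A] {S G N : Subgroup A}
    (h : IsNormallyDense S G) (hSG : S ≤ G) (hS : ⁅S, S⁆ ≠ ⊥)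
    (hN : ∀ a ∈ G, ∀ k ∈ N, a * k * a⁻¹ ∈ N) (hSN : ⁅S, S⁆ ≤ N) : ⁅G, G⁆ ≤ N := by
  have hle : ⁅S, S⁆ ≤ N ⊓ G :=
    le_inf hSN ((Subgroup.commutator_mono hSG hSG).trans (Subgroup.commutator_self_le G))
  have key := h (N ⊓ G) inf_le_right
    (fun a ha k hk => ⟨hN a ha k hk.1, mul_mem (mul_mem ha hk.2) (G.inv_mem ha)⟩)
    (fun hb => hS (le_bot_iff.1 (hle.trans hb.le)))
  rw [Subgroup.commutator_le]
  intro a ha b hb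
  obtain ⟨s, hs, k, hk, rfl⟩ := key a ha
  obtain ⟨t, ht, l, hl, rfl⟩ := key b hb
  have hs' := hSG hs
  have ht' := hSG ht
  have : ⁅s * k, t * l⁆ = (s * k * s⁻¹) * ((s * t) * (l * k⁻¹) * (s * t)⁻¹) *
      ((s * t * s⁻¹) * l⁻¹ * (s * t * s⁻¹)⁻¹) * ⁅s, t⁆ := by
    rw [commutatorElement_def, commutatorElement_def]; group
  rw [this]
  exact mul_mem (mul_mem (mul_mem (hN _ hs' _ hk.1)
    (hN _ (mul_mem hs' ht') _ (mul_mem hl.1 (inv_mem hk.1))))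
    (hN _ (mul_mem (mul_mem hs' ht') (inv_mem hs')) _ (inv_mem hl.1)))
    (hSN (Subgroup.commutator_mem_commutator hs ht))

/-- The labels `k` whose copy below the letter `1` lies in `M` form a group normalised by the first
sections of `A`, hence by the whole spinal group of `D`. `commutator_le` applies to it, and
rotations carry the result to the other letters. -/
theorem geometricPower_commutator_le [Finite R] {A : Subgroup (TreeAut R)}
    (hd : IsNormallyDense (spinalGroup T) (spinalGroup D)) (hTD : T ≤ D)
    (hT : ⁅spinalGroup T, spinalGroup T⁆ ≠ ⊥) (hRA : rootedGroup R ≤ A)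
    (hA : spinalGroup D ≤ firstSec A) (hAM : ∀ a ∈ A, ∀ k ∈ M, a * k * a⁻¹ ∈ M)
    (hM : ∀ k ∈ ⁅spinalGroup T, spinalGroup T⁆, rigid [1] k ∈ M) :
    geometricPower ⁅spinalGroup D, spinalGroup D⁆ ≤ M := by
  have h1 : ⁅spinalGroup D, spinalGroup D⁆ ≤ M.comap (rigid [1]) := by
    refine hd.commutator_le (spinalGroup_mono hTD) hT (fun a ha k hk => ?_) hM
    obtain ⟨m, hm, hm1, rfl⟩ := hA ha
    have := hAM m hm _ hk
    rwa [mul_rigid_singleton, hm1] at this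
  refine geometricPower_le fun x k hk => ?_
  have := hAM _ (hRA (rootedMul_mem_rootedGroup x)) _ (h1 hk)
  rw [mul_rigid_singleton] at this
  simpa using this

theorem conj_mem_geometricPower {X : Type*} {G K : Subgroup (TreeAut X)} {g k : TreeAut X} (hG : ∀ a ∈ G, ∀ x, a.sec [x] ∈ G)
    (hK : ∀ a ∈ G, ∀ k ∈ K, a * k * a⁻¹ ∈ K) (hg : g ∈ G) (hk : k ∈ geometricPower K) :
    g * k * g⁻¹ ∈ geometricPower K := by
  rw [mem_geometricPower] at hk ⊢
  intro x
  refine ⟨by rw [letter_mul, letter_mul, (hk _).1, letter_letter_inv], ?_⟩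
  rw [mul_sec_singleton, mul_sec_singleton, inv_sec_singleton, (hk _).1]
  exact hK _ (hG g hg _) _ (hk _).2

/-- The standing assumptions: `⟨R ∪ T⟩` is a dense subgroup (for the normal topology) of the
constant spinal group `⟨R ∪ D⟩`, and contains the geometric power of its commutator subgroup. -/
structure IsDenseBranchPair (T D : Subgroup (TreeAut R)) : Prop where
  le : T ≤ D
  directed : IsDirectedGroup D
  directed' : IsDirectedGroup T
  dense : IsNormallyDense (spinalGroup T) (spinalGroup D)
  commutator_ne_bot : ⁅spinalGroup T, spinalGroup T⁆ ≠ ⊥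
  branch : geometricPower ⁅spinalGroup T, spinalGroup T⁆ ≤ ⁅spinalGroup T, spinalGroup T⁆

namespace IsDenseBranchPair

theorem rigid_mem (h : IsDenseBranchPair T D) (x : R)
    (hk : k ∈ ⁅spinalGroup T, spinalGroup T⁆) : rigid [x] k ∈ spinalGroup T :=
  Subgroup.commutator_self_le _ (TreeAut.rigid_mem h.branch hk [x])

variable [Finite R]

theorem geometricPower_le (h : IsDenseBranchPair T D) :
    geometricPower ⁅spinalGroup D, spinalGroup D⁆ ≤ ⁅spinalGroup D, spinalGroup D⁆ :=
  geometricPower_commutator_le h.dense h.le h.commutator_ne_bot (rootedGroup_le_spinalGroup D)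
    (h.directed.spinalGroup_le_firstSec le_rfl)
    (fun _ ha _ hk => Subgroup.conj_mem_commutator_self ha hk)
    fun _ hk => Subgroup.commutator_mono (spinalGroup_mono h.le) (spinalGroup_mono h.le)
      (TreeAut.rigid_mem h.branch hk [1])

theorem exists_mul (h : IsDenseBranchPair T D) (hm : m ∈ spinalGroup D) :
    ∃ s ∈ spinalGroup T, ∃ k ∈ geometricPower ⁅spinalGroup D, spinalGroup D⁆, m = s * k := by
  refine h.dense _ (h.geometricPower_le.trans (Subgroup.commutator_self_le _))
    (fun a ha k hk => conj_mem_geometricPower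
      (fun a ha x => sec_singleton_mem_spinalGroup h.directed.directed ha x)
      (fun a ha k hk => Subgroup.conj_mem_commutator_self ha hk) ha hk) (fun hb => ?_) m hm
  obtain hb' | ⟨c, hc, hc1⟩ := ⁅spinalGroup T, spinalGroup T⁆.bot_or_exists_ne_one
  · exact h.commutator_ne_bot hb'
  have hc' := Subgroup.commutator_mono (spinalGroup_mono h.le) (spinalGroup_mono h.le) hc
  have h1 : rigid [1] c ∈ geometricPower ⁅spinalGroup D, spinalGroup D⁆ := by
    refine mem_geometricPower.2 fun x => ⟨by simp, ?_⟩
    by_cases hx : x = 1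
    · subst hx; simpa using hc'
    · rw [sec_rigid_of_ne hx]; exact one_mem _
  rw [hb, Subgroup.mem_bot] at h1
  exact hc1 (by rw [← sec_rigid_self (1 : R) c, h1, one_sec])

/-- Used contrapositively: the first-section group of a proper intermediate subgroup is again
proper. -/
theorem spinalGroup_le_of_le_firstSec (h : IsDenseBranchPair T D) (hTM : spinalGroup T ≤ M)
    (hM : spinalGroup D ≤ firstSec M) : spinalGroup D ≤ M := by
  have h1 : geometricPower ⁅spinalGroup D, spinalGroup D⁆ ≤ M :=
    geometricPower_commutator_le h.dense h.le h.commutator_ne_bot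
      ((rootedGroup_le_spinalGroup T).trans hTM) hM
      (fun a ha k hk => mul_mem (mul_mem ha hk) (inv_mem ha))
      fun k hk => hTM (h.rigid_mem 1 hk)
  intro m hm
  obtain ⟨s, hs, k, hk, rfl⟩ := h.exists_mul hm
  exact mul_mem (hTM hs) (h1 hk)

theorem sec_mem_of_covBy (h : IsDenseBranchPair T D) (hc : T ⋖ D) (n : ℕ)
    (hTM : spinalGroup T ≤ M) (hMD : M ≤ spinalGroup D) (hne : M ≠ spinalGroup D) (hm : m ∈ M)
    (hsec : ∀ v : List R, v.length = n → m.sec v ∈ D ∨ m.sec v ∈ rootedGroup R) :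
    ∀ v : List R, v.length = n → m.sec v ∈ spinalGroup T := by
  have hR := (rootedGroup_le_spinalGroup T).trans hTM
  induction n generalizing M m with
  | zero =>
    intro v hv
    rw [List.length_eq_zero_iff.1 hv, sec_nil]
    have h0 := hsec [] rfl
    rw [sec_nil] at h0
    rcases h0 with h0 | h0
    · have hT : T ≤ M ⊓ D := le_inf ((le_spinalGroup T).trans hTM) hc.le
      -- Maximality of `T` leaves only `M ⊓ D = T` or `M ⊓ D = D`, and the latter would make `M`
      -- everything.
      rcases hc.eq_or_eq hT inf_le_right with he | he
      · rw [← he]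
        exact le_spinalGroup _ ⟨hm, h0⟩
      · exact absurd (le_antisymm hMD (spinalGroup_le hR (inf_eq_right.1 he))) hne
    · exact rootedGroup_le_spinalGroup T h0
  | succ n ih =>
    intro v hv
    cases v with
    | nil => simp at hv
    | cons x v =>
      rw [sec_cons]
      refine ih (M := firstSec M) (h.directed'.spinalGroup_le_firstSec hTM)
        (h.directed.firstSec_le hMD) (fun he => hne (le_antisymm hMD
          (h.spinalGroup_le_of_le_firstSec hTM he.ge))) (sec_mem_firstSec hR hm x)
        (fun w hw => ?_) ?_ v (by simpa using hv)
      · rw [← sec_cons]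
        exact hsec _ (by simp [hw])
      · exact (rootedGroup_le_spinalGroup T).trans (h.directed'.spinalGroup_le_firstSec hTM)

theorem mem_of_sec_singleton_mem (h : IsDenseBranchPair T D) (hm : m ∈ spinalGroup D)
    (hsec : ∀ x, m.sec [x] ∈ spinalGroup T) : m ∈ spinalGroup T := by
  obtain ⟨s, hs, k, hk, rfl⟩ := h.exists_mul hm
  refine mul_mem hs ?_
  have hk' := mem_geometricPower.1 hk
  have hle : geometricPower (spinalGroup T ⊓ ⁅spinalGroup D, spinalGroup D⁆) ≤ spinalGroup T := by
    refine TreeAut.geometricPower_le fun x l hl => ?_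
    obtain ⟨t, ht, ht', c, hc, rfl⟩ :=
      exists_eq_mul_of_mem_commutator h.directed.directed h.le hl.1 hl.2
    rw [map_mul]
    refine mul_mem ?_ (h.rigid_mem x hc)
    have hdir := h.directed.directed t (h.le ht)
    -- As `t` is its own section at `1`, this element has trivial section there. Elsewhere its
    -- sections are inverse labels of `t ∈ ⁅D, D⁆`, which are commutators in `R`, so branching
    -- applies.
    have h1 : t⁻¹ * rigid [1] t ∈ spinalGroup T := by
      refine Subgroup.commutator_self_le _ (h.branch (mem_geometricPower.2 fun y => ⟨?_, ?_⟩))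
      · rw [letter_mul, letter_rigid]
        conv_lhs => rw [← hdir.letter y]
        exact letter_inv_letter t y
      · have hy : (t⁻¹).letter y = y := by
          conv_lhs => rw [← hdir.letter y]
          exact letter_inv_letter t y
        rw [mul_sec_singleton, letter_rigid, inv_sec_singleton, hy]
        by_cases hy1 : y = 1
        · subst hy1
          rw [hdir.sec_one, sec_rigid_self, inv_mul_cancel]
          exact one_mem _
        · rw [sec_rigid_of_ne hy1, mul_one]
          have hle := rootedGroup_le_spinalGroup T
          exact inv_mem (Subgroup.commutator_mono hle hle
            (sec_mem_commutator_of_mem_commutator h.directed.directed ht' hy1))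
    have h2 := mul_mem (le_spinalGroup T ht) h1
    rw [mul_inv_cancel_left] at h2
    have h3 := mul_mem (mul_mem (rootedMul_mem_spinalGroup T x) h2)
      (inv_mem (rootedMul_mem_spinalGroup T x))
    rw [mul_rigid_singleton] at h3
    simpa using h3
  refine hle (mem_geometricPower.2 fun x => ⟨(hk' x).1, ?_, (hk' x).2⟩)
  have h1 := hsec x
  rw [mul_sec_singleton, (hk' x).1] at h1
  exact (Subgroup.mul_mem_cancel_left _
    (sec_singleton_mem_spinalGroup h.directed'.directed hs x)).1 h1

theorem mem_of_sec_mem (h : IsDenseBranchPair T D) (n : ℕ) (hm : m ∈ spinalGroup D)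
    (hsec : ∀ v : List R, v.length = n → m.sec v ∈ spinalGroup T) : m ∈ spinalGroup T := by
  induction n generalizing m with
  | zero => simpa using hsec [] rfl
  | succ n ih =>
    refine h.mem_of_sec_singleton_mem hm fun x => ih
      (sec_singleton_mem_spinalGroup h.directed.directed hm x) fun v hv => ?_
    rw [← sec_cons]
    exact hsec _ (by simp [hv])

end IsDenseBranchPair

variable [Finite R]

/-- An element equal to its own section at `1` can be rewritten by ever shorter words over `T` until
it lies in `T`. -/
theorem spinalGroup_inf (hD : ∀ d ∈ D, IsDirectedAut d) (hTD : T ≤ D) : spinalGroup T ⊓ D = T :=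
  le_antisymm (fun _ hd => mem_of_mem_spinalGroup (fun t ht => hD t (hTD ht)) hd.1
    (hD _ hd.2).sec_one) (le_inf (le_spinalGroup T) hTD)

theorem spinalGroup_lt (hD : ∀ d ∈ D, IsDirectedAut d) (hTD : T < D) :
    spinalGroup T < spinalGroup D := by
  refine lt_of_le_of_ne (spinalGroup_mono hTD.le) fun he => hTD.ne ?_
  rw [← spinalGroup_inf hD hTD.le, he]
  exact inf_eq_right.2 (le_spinalGroup D)

theorem covBy_of_spinalGroup_covBy (hD : ∀ d ∈ D, IsDirectedAut d) (hTD : T ≤ D)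
    (h : spinalGroup T ⋖ spinalGroup D) : T ⋖ D := by
  refine ⟨lt_of_le_of_ne hTD fun he => h.ne (he ▸ rfl), fun E hTE hED => ?_⟩
  exact h.2 (spinalGroup_lt (fun e he => hD e (hED.le he)) hTE) (spinalGroup_lt hD hED)

theorem IsDenseBranchPair.spinalGroup_covBy (h : IsDenseBranchPair T D) (hc : T ⋖ D) :
    spinalGroup T ⋖ spinalGroup D := by
  refine ⟨spinalGroup_lt h.directed.directed hc.lt, fun M hTM hMD => hTM.not_ge fun m hm => ?_⟩
  obtain ⟨k, hk⟩ := exists_layer_sec_mem h.directed.directed (hMD.le hm)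
  exact h.mem_of_sec_mem k (hMD.le hm)
    (h.sec_mem_of_covBy hc k hTM.le hMD.le hMD.ne hm fun v hv => hk v hv.ge)

end Prodense

/-! ### Transferring the branch property from the conjugate `H` to `⟨R ∪ T⟩`. -/

section Conjugation

open TreeAut

variable {R : Type*} [Group R] {D T H : Subgroup (TreeAut R)} {g k d h : TreeAut R}

theorem IsSphericallyTransitive.of_map_conj {X : Type*} {S : Subgroup (TreeAut X)} {g : TreeAut X}
    (h : IsSphericallyTransitive (S.map (MulAut.conj g).toMonoidHom)) :
    IsSphericallyTransitive S := fun u v huv => by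
  obtain ⟨_, ⟨s, hs, rfl⟩, hsv⟩ := h (g.1 u) (g.1 v) (by simp [length_apply, huv])
  refine ⟨s, hs, g.1.injective ?_⟩
  rw [← hsv]
  have h1 : (MulAut.conj g).toMonoidHom s = g * s * g⁻¹ := rfl
  rw [h1, mul_apply, mul_apply, inv_apply_apply]

theorem mem_map_conj {A : Type*} [Group A] {S : Subgroup A} {g k : A} :
    k ∈ S.map (MulAut.conj g).toMonoidHom ↔ g⁻¹ * k * g ∈ S := by
  constructor
  · rintro ⟨s, hs, rfl⟩
    simpa [mul_assoc] using hs
  · intro h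
    exact ⟨_, h, by simp [mul_assoc]⟩

theorem conj_mem_map_conj {A : Type*} [Group A] {S : Subgroup A} {g s : A} (hs : s ∈ S) :
    g * s * g⁻¹ ∈ S.map (MulAut.conj g).toMonoidHom :=
  ⟨s, hs, rfl⟩

variable [Finite R]

/-- An element of a spinal group whose conjugate by a directed automorphism outside the spinal group
lies in the spinal group fixes the ray `1, 1, 1, …`. -/
theorem apply_replicate_of_conj_mem (hD : ∀ d ∈ D, IsDirectedAut d) (hTD : T ≤ D) (hd : d ∈ D)
    (hdT : d ∉ spinalGroup T) (hh : h ∈ spinalGroup T) (hdh : d⁻¹ * h * d ∈ spinalGroup T) (n : ℕ) :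
    h.1 (List.replicate n 1) = List.replicate n 1 := by
  have hT : ∀ t ∈ T, IsDirectedAut t := fun t ht => hD t (hTD ht)
  have hd1 := (hD d hd).sec_one
  have hd2 := (hD _ (inv_mem hd))
  induction n generalizing h with
  | zero => simp
  | succ n ih =>
    have hs := sec_singleton_mem_spinalGroup hT hh 1
    have hs' := sec_singleton_mem_spinalGroup hT hdh 1
    rw [mul_sec_singleton, mul_sec_singleton, (hD d hd).letter, hd1] at hs'
    -- If `h` moved `1`, the section of `d⁻¹ * h * d` at `1` would be a rooted element times a
    -- section of `h` times `d`, forcing `d` into the spinal group of `T`.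
    have h1 : h.letter 1 = 1 := by
      by_contra hne
      refine hdT ?_
      have h2 := rootedGroup_le_spinalGroup T (hd2.sec_ne_one _ hne)
      exact (Subgroup.mul_mem_cancel_left _ (mul_mem h2 hs)).1 hs'
    rw [h1, hd2.sec_one] at hs'
    rw [List.replicate_succ, apply_cons, h1, ih hs hs']

variable (hD : IsDirectedGroup D) (hT : IsDirectedGroup T) (hTD : T ≤ D) (hg : g ∈ spinalGroup D)
  (hH : H = (spinalGroup T).map (MulAut.conj g).toMonoidHom)
  (htrans : IsSphericallyTransitive H) (hbr : geometricPower ⁅H, H⁆ ≤ ⁅H, H⁆)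
include hT hH hbr

/-- By branching, a copy of `k` can be planted below `g(v)` inside `H`; conjugating back by `g` puts
the conjugated label below `v`. -/
theorem sec_conj_mem_of_mem_commutator (hk : k ∈ ⁅H, H⁆) (v : List R) :
    (g.sec v)⁻¹ * k * g.sec v ∈ spinalGroup T := by
  have h1 := Subgroup.commutator_self_le _ (rigid_mem hbr hk (g.1 v))
  rw [hH, mem_map_conj] at h1
  have h2 := mul_rigid g⁻¹ (g.1 v) k
  rw [inv_inv, inv_apply_apply, inv_sec, inv_apply_apply, inv_inv] at h2
  rw [h2] at h1
  have h3 := sec_mem_spinalGroup hT.directed h1 v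
  rwa [sec_rigid] at h3

include hD hTD hg htrans in
theorem exists_layer_sec_mem_spinalGroup [Nontrivial R] :
    ∃ n, ∀ v : List R, v.length = n → g.sec v ∈ spinalGroup T := by
  obtain ⟨n, hn⟩ := exists_layer_sec_mem hD.directed hg
  refine ⟨n, fun v hv => ?_⟩
  rcases hn v hv.ge with hd | hd
  · by_contra hdT
    obtain ⟨y, hy⟩ := exists_ne (1 : R)
    -- Suppose `g.sec v` is directed and outside the group. At `v ++ [y]` with `y ≠ 1` the section
    -- is rooted, so `k` itself lies in the group; at `v` its conjugate by `g.sec v` does too. Thus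
    -- `k` fixes the ray of `1`s, and by normality and transitivity `⁅H, H⁆` would fix every word.
    have hfix : ∀ k ∈ ⁅H, H⁆, ∀ n, k.1 (List.replicate n 1) = List.replicate n 1 := by
      intro k hk
      have h1 := sec_conj_mem_of_mem_commutator hT hH hbr hk (v ++ [y])
      have hy' := rootedGroup_le_spinalGroup T ((hD.directed _ hd).sec_ne_one y hy)
      rw [sec_append] at h1
      have h2 := (Subgroup.mul_mem_cancel_left _ (inv_mem hy')).1
        ((Subgroup.mul_mem_cancel_right _ hy').1 h1)
      exact apply_replicate_of_conj_mem hD.directed hTD hd hdT h2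
        (sec_conj_mem_of_mem_commutator hT hH hbr hk v)
    refine hT.commutator_ne_bot ?_
    rw [eq_bot_iff]
    intro c hc
    have hc' : g * c * g⁻¹ ∈ ⁅H, H⁆ := by
      rw [hH, ← Subgroup.map_commutator]
      exact conj_mem_map_conj hc
    have h3 : g * c * g⁻¹ = 1 := by
      refine ext_apply fun u => ?_
      obtain ⟨a, ha, ha'⟩ := htrans (List.replicate u.length 1) u (by simp)
      have h4 := hfix _ (Subgroup.conj_mem_commutator_self (inv_mem ha) hc') u.length
      rw [inv_inv, mul_apply, mul_apply, ha'] at h4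
      rw [one_apply, ← apply_inv_apply a ((g * c * g⁻¹).1 u), h4, ha']
    rw [Subgroup.mem_bot]
    rwa [mul_inv_eq_one, mul_eq_left] at h3
  · exact rootedGroup_le_spinalGroup T hd

theorem commutator_le_spinalGroup {n : ℕ}
    (hn : ∀ v : List R, v.length = n → g.sec v ∈ spinalGroup T) : ⁅H, H⁆ ≤ spinalGroup T :=
  fun k hk => by
    have h1 := sec_conj_mem_of_mem_commutator hT hH hbr hk (List.replicate n 1)
    have h2 := hn (List.replicate n 1) (by simp)
    exact (Subgroup.mul_mem_cancel_left _ (inv_mem h2)).1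
      ((Subgroup.mul_mem_cancel_right _ h2).1 h1)

include hD hTD hg in
-- `g` need not lie in the spinal group of `T`, but its sections at layer `n` do, so the extended
-- abelianization map is defined at `g` and cannot see conjugation by it.
theorem commutator_le_commutator {n : ℕ}
    (hn : ∀ v : List R, v.length = n → g.sec v ∈ spinalGroup T) :
    ⁅H, H⁆ ≤ ⁅spinalGroup T, spinalGroup T⁆ := fun k hk => by
  have hkS := commutator_le_spinalGroup hT hH hbr hn hk
  rw [hH, ← Subgroup.map_commutator] at hk
  obtain ⟨s, hs, rfl⟩ := hk
  obtain ⟨Q, f, hQ, hf⟩ := exists_spinalAb_extension hT.directed n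
  have hsS := Subgroup.commutator_self_le _ hs
  have hSQ : ∀ a ∈ spinalGroup T, a ∈ Q := fun a ha =>
    (hQ a).2 fun v _ => sec_mem_spinalGroup hT.directed ha v
  have hgQ : g ∈ Q := (hQ g).2 hn
  refine mem_commutator_of_spinalAb_eq_one hT.directed hkS ?_ ?_
  · rw [← hf _ hkS (hSQ _ hkS)]
    have h1 : (⟨_, hSQ _ hkS⟩ : Q) = ⟨g, hgQ⟩ * ⟨s, hSQ s hsS⟩ * ⟨g, hgQ⟩⁻¹ := rfl
    rw [h1, map_mul, map_mul, map_inv, mul_comm, inv_mul_cancel_left, hf _ hsS,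
      spinalAb_eq_one_of_mem_commutator hT.directed hs]
  · exact rootedMul_letter_mem_commutator hD.directed
      (Subgroup.conj_mem_commutator_self hg
        (Subgroup.commutator_mono (spinalGroup_mono hTD) (spinalGroup_mono hTD) hs))

include hD hTD hg in
-- A subgroup `E` of finite index in `⁅H, H⁆` and normalised by `g` has the same index in the two
-- commutator subgroups, which are conjugate by `g`. As one contains the other, they coincide.
theorem commutator_eq_commutator (hfin : (geometricPower ⁅H, H⁆).IsFiniteRelIndex ⁅H, H⁆) {n : ℕ}
    (hn : ∀ v : List R, v.length = n → g.sec v ∈ spinalGroup T) :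
    ⁅H, H⁆ = ⁅spinalGroup T, spinalGroup T⁆ := by
  have hle := commutator_le_commutator hD hT hTD hg hH hbr hn
  refine le_antisymm hle ?_
  let W : Subgroup (TreeAut R) :=
    spinalGroup T ⊓ ⨅ v : {v : List R // v.length = n}, ⁅H, H⁆.comap (rigid v.1)
  have hW : ∀ a, a ∈ W ↔ a ∈ spinalGroup T ∧ ∀ v : List R, v.length = n → rigid v a ∈ ⁅H, H⁆ := by
    intro a
    simp [W, Subgroup.mem_inf, Subgroup.mem_iInf]
  have hWconj : ∀ s ∈ spinalGroup T, ∀ a ∈ W, s * a * s⁻¹ ∈ W := by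
    intro s hs a ha
    rw [hW] at ha ⊢
    refine ⟨mul_mem (mul_mem hs ha.1) (inv_mem hs), fun v hv => ?_⟩
    have hgw := hn ((g⁻¹).1 v) (by rw [length_apply, hv])
    -- The section of `q` is chosen so that `g * q * g⁻¹`, an element of `H`, fixes `v` and has
    -- section `s` there.
    obtain ⟨q, hq, hq1, hq2⟩ := hT.exists_sec_eq
      (mul_mem (mul_mem (inv_mem hgw) hs) hgw) ((g⁻¹).1 v)
    have hqH : g * q * g⁻¹ ∈ H := hH ▸ conj_mem_map_conj hq
    have h1 := Subgroup.conj_mem_commutator_self hqH (ha.2 v hv)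
    have h2 : (g * q * g⁻¹).1 v = v := by
      rw [mul_apply, mul_apply, hq1, apply_inv_apply]
    have h3 : (g * q * g⁻¹).sec v = s := by
      rw [mul_sec, mul_sec, hq1, hq2, inv_sec]
      group
    rwa [mul_rigid, h2, h3] at h1
  let E : Subgroup (TreeAut R) :=
    Subgroup.closure {a | ∃ v : List R, v.length = n ∧ ∃ k ∈ W, rigid v k = a}
  have hEH : E ≤ ⁅H, H⁆ := by
    rw [Subgroup.closure_le]
    rintro _ ⟨v, hv, k, hk, rfl⟩
    exact ((hW k).1 hk).2 v hv
  have hEconj : ∀ a : TreeAut R, (∀ v : List R, v.length = n → a.sec v ∈ spinalGroup T) →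
      E.map (MulAut.conj a).toMonoidHom ≤ E := by
    intro a ha
    rw [Subgroup.map_le_iff_le_comap, Subgroup.closure_le]
    rintro _ ⟨v, hv, k, hk, rfl⟩
    rw [SetLike.mem_coe, Subgroup.mem_comap, MulEquiv.coe_toMonoidHom, MulAut.conj_apply,
      mul_rigid]
    exact Subgroup.subset_closure ⟨_, by rw [length_apply, hv], _, hWconj _ (ha v hv) k hk, rfl⟩
  have hEg : E.map (MulAut.conj g).toMonoidHom = E := by
    refine le_antisymm (hEconj g hn) fun e he => ?_
    rw [mem_map_conj]
    have h1 := hEconj g⁻¹ (fun v hv => by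
      rw [inv_sec]; exact inv_mem (hn _ (by rw [length_apply, hv]))) (conj_mem_map_conj he)
    rwa [inv_inv] at h1
  have hEfin : E.relIndex ⁅H, H⁆ ≠ 0 := by
    have h1 := geometricPower_iterate_isFiniteRelIndex hbr hfin n
    rw [Subgroup.isFiniteRelIndex_iff_relIndex_ne_zero] at h1
    refine mt (Subgroup.relIndex_eq_zero_of_le_left ?_) h1
    -- `W` contains `⁅H, H⁆`, so `E` contains its `n`-fold geometric power, which has finite index.
    refine geometricPower_iterate_le n fun v hv k hk => Subgroup.subset_closure ⟨v, hv, k, ?_, rfl⟩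
    exact (hW k).2 ⟨commutator_le_spinalGroup hT hH hbr hn hk, fun w _ => rigid_mem hbr hk w⟩
  have hindex : E.relIndex ⁅H, H⁆ = E.relIndex ⁅spinalGroup T, spinalGroup T⁆ := by
    conv_lhs => rw [hH, ← Subgroup.map_commutator, ← hEg]
    exact Subgroup.relIndex_map_map_of_injective _ _ (MulAut.conj g).injective
  have hmul := Subgroup.relIndex_mul_relIndex _ _ _ hEH hle
  rw [← hindex] at hmul
  exact Subgroup.relIndex_eq_one.1 (Nat.eq_of_mul_eq_mul_left (Nat.pos_of_ne_zero hEfin)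
    (by rw [hmul, mul_one]))

end Conjugation

/-! ### The degenerate alphabet and the main theorem. -/

theorem TreeAut.subsingleton (X : Type*) [Subsingleton X] : Subsingleton (TreeAut X) :=
  ⟨fun a b => TreeAut.ext_apply fun u => List.ext_getElem (by simp [TreeAut.length_apply])
    fun _ _ _ => Subsingleton.elim _ _⟩

theorem mainTheorem2 {R : Type*} [Group R] [Finite R] (D T H : Subgroup (TreeAut R))
    (hD : IsDirectedGroup D) (hTD : T ≤ D)
    (hconj : ∃ g ∈ spinalGroup D, H = (spinalGroup T).map (MulAut.conj g).toMonoidHom)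
    (hprodense : IsProdenseIn H (spinalGroup D))
    (hbranch : IsRegularBranchOver H ⁅H, H⁆) :
    H ⋖ spinalGroup D ↔ T ⋖ D := by
  -- For trivial `R` the whole automorphism group is trivial, and both maximality statements fail.
  rcases subsingleton_or_nontrivial R with hR | hR
  · have := TreeAut.subsingleton R
    exact ⟨fun h => absurd (Subsingleton.elim _ _) h.ne, fun h => absurd (Subsingleton.elim _ _) h.ne⟩
  obtain ⟨g, hg, hH⟩ := hconj
  have hT : IsDirectedGroup T := isDirectedGroup_of_isSphericallyTransitive
    (fun t ht => hD.directed t (hTD ht)) (IsSphericallyTransitive.of_map_conj (hH ▸ hbranch.transitive))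
  obtain ⟨n, hn⟩ := exists_layer_sec_mem_spinalGroup hD hT hTD hg hH hbranch.transitive
    hbranch.geometric_le
  have heq := commutator_eq_commutator hD hT hTD hg hH hbranch.geometric_le
    hbranch.geometric_finiteIndex hn
  have hpair : IsDenseBranchPair T D :=
    { le := hTD
      directed := hD
      directed' := hT
      dense := fun N hNG hN hN' m hm =>
        IsProdenseIn.exists_mul hg (hH ▸ hprodense) N hNG hN hN' hm
      commutator_ne_bot := hT.commutator_ne_bot
      branch := heq ▸ hbranch.geometric_le }
  have hcov : H ⋖ spinalGroup D ↔ spinalGroup T ⋖ spinalGroup D := by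
    have hG : (spinalGroup D).map (MulAut.conj g).toMonoidHom = spinalGroup D := by
      ext a
      rw [mem_map_conj, Subgroup.mul_mem_cancel_right _ hg,
        Subgroup.mul_mem_cancel_left _ (inv_mem hg)]
    rw [hH, ← hG]
    conv_rhs => rw [hG]
    exact apply_covBy_apply_iff (MulAut.conj g).mapSubgroup
  rw [hcov]
  exact ⟨covBy_of_spinalGroup_covBy hD.directed hTD, hpair.spinalGroup_covBy⟩
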